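/- Let $\sigma>0$. A memoryless Rayleigh-fading channel with input $X\in\mathbb{C}$ has the unquantized output $\tilde Y=HX+Z$, where $X,H,Z$ are independent, and where $H$ and $Z$ are zero-mean, circularly-symmetric, complex Gaussian, $H$ with variance $\mathsf{E}|H|^2=1$ and $Z$ with variance $\mathsf{E}|Z|^2=\sigma^2$. The real and the imaginary part of $\tilde Y$ are quantized separately by one-bit quantizers: for Borel sets $\mathcal{D}_R,\mathcal{D}_I\subseteq\mathbb{R}$, the receiver observes $Y=(Y_R,Y_I)$, where $Y_R=1$ if $\operatorname{Re}\tilde Y\in\mathcal{D}_R$ and $Y_R=0$ otherwise, and where $Y_I=1$ if $\operatorname{Im}\tilde Y\in\mathcal{D}_I$ and $Y_I=0$ otherwise. In the coherent case the receiver also knows $H$, and $\mathcal{D}_R,\mathcal{D}_I$ may depend on $H$ (in a jointly Borel way); in the noncoherent case they are fixed. The capacity $C(P)$ is the supremum of $I(X;Y\mid H)$ (coherent case) or of $I(X;Y)$ (noncoherent case), in nats, over all laws of $X$ with $\mathsf{E}|X|^2\le P$ and over all $\mathcal{D}_R,\mathcal{D}_I$. The capacity per unit-energy is $\dot C(0)=\sup_{P>0}C(P)/P$.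 With $D$ denoting relative entropy, put, for $\xi\in\mathbb{C}\setminus\{0\}$, $$R(\xi,\mathcal{D}_R,\mathcal{D}_I)=\frac{\int D\bigl(P_{Y\mid H=h,X=\xi}\,\big\|\,P_{Y\mid H=h,X=0}\bigr)\,dP_H(h)}{|\xi|^2}\quad\text{or}\quad R(\xi,\mathcal{D}_R,\mathcal{D}_I)=\frac{D\bigl(P_{Y\mid X=\xi}\,\big\|\,P_{Y\mid X=0}\bigr)}{|\xi|^2}$$ in the coherent or the noncoherent case, respectively. Let $Q(x)=\frac{1}{\sqrt{2\pi}}\int_x^\infty e^{-t^2/2}\,dt$. In both cases $$\dot C(0)=\sup_{\xi\ne 0,\,\mathcal{D}_R,\,\mathcal{D}_I}R(\xi,\mathcal{D}_R,\mathcal{D}_I),$$ and the following hold. 1. In the coherent case $\dot C(0)=1/\sigma^2$. This is achieved by quantization regions of the form $\mathcal{D}_R=\{u\in\mathbb{R}: u\ge T_R\}$ and $\mathcal{D}_I=\{u\in\mathbb{R}: u\ge T_I\}$, where the thresholds $T_R$ and $T_I$ are Borel functions of $\operatorname{Re}(H\xi)$ and of $\operatorname{Im}(H\xi)$, respectively: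 for such regions $\sup_{\xi\neq 0}R(\xi,\mathcal{D}_R,\mathcal{D}_I)=1/\sigma^2$. 2. In the noncoherent case $$\frac{2Q(1)}{\sigma^2}\le\dot C(0)<\frac{1}{\sigma^2}.$$ The lower bound is achieved by the quantization regions $\mathcal{D}_R=\{u\in\mathbb{R}: u^2\ge T_R\}$ and $\mathcal{D}_I=\{u\in\mathbb{R}: u^2\ge T_I\}$ with $T_R=T_I=(|\xi|^2+\sigma^2)/2$: for these regions $\sup_{\xi\ne0}R(\xi,\mathcal{D}_R,\mathcal{D}_I)\ge 2Q(1)/\sigma^2$, and $R(\xi,\mathcal{D}_R,\mathcal{D}_I)\to 2Q(1)/\sigma^2$ as $|\xi|\to\infty$. -/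

import Mathlib

open MeasureTheory ProbabilityTheory InformationTheory Set Filter Topology
open scoped ENNReal NNReal

namespace FadingChannel

noncomputable section

/-- The Gaussian Q-function `Q(x) = (2π)^(-1/2) ∫_x^∞ exp(-t²/2) dt`. -/
def gaussianQ (x : ℝ) : ℝ :=
  (Real.sqrt (2 * Real.pi))⁻¹ * ∫ t in Ioi x, Real.exp (-t ^ 2 / 2)

/-- The zero-mean circularly-symmetric complex Gaussian law of variance `v`: the real and the
imaginary part are independent centred real Gaussians of variance `v / 2` each. -/
def circGaussian (v : ℝ≥0) : Measure ℂ :=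
  ((gaussianReal 0 (v / 2)).prod (gaussianReal 0 (v / 2))).map (fun p => (⟨p.1, p.2⟩ : ℂ))

/-- The law of the Rayleigh fading `H` (unit variance). -/
def fadingLaw : Measure ℂ := circGaussian 1

/-- The law of the additive noise `Z` (variance `σ²`). -/
def noiseLaw (σ : ℝ) : Measure ℂ := circGaussian (Real.toNNReal (σ ^ 2))

open scoped Classical in
/-- The pair of one-bit quantizers: the first bit says whether `Re y ∈ A`, the second one
whether `Im y ∈ B`. -/
def quantize (A B : Set ℝ) (y : ℂ) : Bool × Bool :=
  (decide (y.re ∈ A), decide (y.im ∈ B))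

/-- The mutual information (in nats) of a pair of random variables with joint law `J`. -/
def mutualInfo {α β : Type*} [MeasurableSpace α] [MeasurableSpace β] (J : Measure (α × β)) :
    ℝ≥0∞ :=
  klDiv J (J.fst.prod J.snd)

/-- Laws of the channel input `X` with `E[|X|²] ≤ P`. -/
def IsAdmissibleInput (P : ℝ) (μ : Measure ℂ) : Prop :=
  IsProbabilityMeasure μ ∧ ∫⁻ x, ‖x‖ₑ ^ 2 ∂μ ≤ ENNReal.ofReal P

/-! ### Coherent case: the quantization regions may depend on the fading -/

/-- A quantization region that depends on the fading `h` in a (jointly) Borel way. -/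
def IsBorelFamily (A : ℂ → Set ℝ) : Prop :=
  MeasurableSet {p : ℂ × ℝ | p.2 ∈ A p.1}

/-- `I(X; Y_R, Y_I | H)` for an input of law `μ`, independent of `H` and `Z`: the average over
the fading of the mutual information between `X` and the quantized version of `h X + Z`. -/
def cohInfo (σ : ℝ) (A B : ℂ → Set ℝ) (μ : Measure ℂ) : ℝ≥0∞ :=
  ∫⁻ h, mutualInfo ((μ.prod (noiseLaw σ)).map
    (fun p => (p.1, quantize (A h) (B h) (h * p.1 + p.2)))) ∂fadingLaw

/-- The capacity `C(P)` in the coherent case. -/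
def cohCapacity (σ P : ℝ) : ℝ≥0∞ :=
  ⨆ (A : ℂ → Set ℝ) (B : ℂ → Set ℝ) (μ : Measure ℂ) (_ : IsBorelFamily A)
    (_ : IsBorelFamily B) (_ : IsAdmissibleInput P μ), cohInfo σ A B μ

/-- The capacity per unit-energy in the coherent case. -/
def cohCapacityPerEnergy (σ : ℝ) : ℝ≥0∞ :=
  ⨆ (P : ℝ) (_ : 0 < P), cohCapacity σ P / ENNReal.ofReal P

/-- The law of the quantized output given `(H, X) = (h, x)`. -/
def cohOutput (σ : ℝ) (A B : ℂ → Set ℝ) (h x : ℂ) : Measure (Bool × Bool) :=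
  (noiseLaw σ).map (fun z => quantize (A h) (B h) (h * x + z))

/-- `D(P_{Y|H,X=ξ} ‖ P_{Y|H,X=0} | P_H) / |ξ|²`, where `Y = (Y_R, Y_I)`. -/
def cohRate (σ : ℝ) (A B : ℂ → Set ℝ) (ξ : ℂ) : ℝ≥0∞ :=
  (∫⁻ h, klDiv (cohOutput σ A B h ξ) (cohOutput σ A B h 0) ∂fadingLaw) / ‖ξ‖ₑ ^ 2

/-! ### Noncoherent case: the quantization regions are fixed -/

/-- `I(X; Y_R, Y_I)` for an input of law `μ`, where `X`, `H`, `Z` are independent. -/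
def noncohInfo (σ : ℝ) (A B : Set ℝ) (μ : Measure ℂ) : ℝ≥0∞ :=
  mutualInfo ((μ.prod (fadingLaw.prod (noiseLaw σ))).map
    (fun p => (p.1, quantize A B (p.2.1 * p.1 + p.2.2))))

/-- The capacity `C(P)` in the noncoherent case. -/
def noncohCapacity (σ P : ℝ) : ℝ≥0∞ :=
  ⨆ (A : Set ℝ) (B : Set ℝ) (μ : Measure ℂ) (_ : MeasurableSet A)
    (_ : MeasurableSet B) (_ : IsAdmissibleInput P μ), noncohInfo σ A B μ

/-- The capacity per unit-energy in the noncoherent case. -/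
def noncohCapacityPerEnergy (σ : ℝ) : ℝ≥0∞ :=
  ⨆ (P : ℝ) (_ : 0 < P), noncohCapacity σ P / ENNReal.ofReal P

/-- The law of the quantized output given `X = x`. -/
def noncohOutput (σ : ℝ) (A B : Set ℝ) (x : ℂ) : Measure (Bool × Bool) :=
  (fadingLaw.prod (noiseLaw σ)).map (fun p => quantize A B (p.1 * x + p.2))

/-- `D(P_{Y|X=ξ} ‖ P_{Y|X=0}) / |ξ|²`, where `Y = (Y_R, Y_I)`. -/
def noncohRate (σ : ℝ) (A B : Set ℝ) (ξ : ℂ) : ℝ≥0∞ :=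
  klDiv (noncohOutput σ A B ξ) (noncohOutput σ A B 0) / ‖ξ‖ₑ ^ 2

/-- The region of a quantizer that compares the energy `u²` with the threshold `T`. -/
def energyRegion (T : ℝ) : Set ℝ := {u | T ≤ u ^ 2}

end

end FadingChannel

open FadingChannel

/-! The mutual information of a channel is at most the mean relative entropy between its output laws
and the output law of the input `0` (`mutualInfo_channel_le`, a consequence of the chain rule). So a
bound `D(P_{Y|X=x} ‖ P_{Y|X=0}) ≤ R |x|²` bounds the capacity per unit-energy by `R`. Conversely, an
input that is `ξ` with a small probability `δ`, and `0` otherwise, conveys at least `δ` times the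
relative entropy between the output law of `ξ` and the mixture of the two output laws
(`le_mutualInfo_onOff`); on a finite output space this tends, after division by `δ`, to
`D(P_{Y|X=ξ} ‖ P_{Y|X=0})` as `δ → 0` (`tendsto_klDiv_mixture`), and in the coherent case Fatou's lemma
carries the limit through the average over the fading.

Coherent case. Data processing bounds the relative entropy given `H = h` by the one between two
Gaussian laws with means `h ξ` and `0`, which is `|h ξ|² / σ²`, with average `|ξ|² / σ²`
(`cohRate_le`). The bound is approached as `|ξ| → ∞` by thresholds at distance `b - √b` from the
origin, where `b` is the distance of the noiseless component: the bit then detects the signal with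
probability tending to `1`, while its false-alarm probability has the exponent `b² / (2v)` of an
optimal test, to first order, where `v` is the variance of the noise component. Fatou's lemma applies
again (`le_iSup_cohRate_threshold`).

Noncoherent case. Given `X = ξ`, the two components of the unquantized output are independent centred
Gaussians of variance `v = (|ξ|² + σ²) / 2` (`map_mul_add_circGaussian`), against `w = σ² / 2` without a
signal, and both components together have relative entropy `x - log (1 + x)` with
`x = v / w - 1 = |ξ|² / σ²`. This stays away from `x` by a fixed factor only for bounded `x`. For large
`x` the loss comes from the quantizer: let `C` be a cell that is likely without a signal, so that
only its complement contributes more than a constant. If a fixed part of the low-energy event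
`v / 4 ≤ u² ≤ v / 2` lies in the complement of `C`, then that complement is too likely without a signal
to contribute more than `x / 4`; otherwise `C` takes away a fixed fraction of the second moment, which
bounds the contribution of the complement (`cellDiv_add_compl_le`). Together this gives a factor `c < 1`
that is uniform in `ξ` and in the quantizer (`exists_klDiv_bitLaw_le`). For energy detection with
threshold `v`, each bit has probability `2 Q(1)` with a signal and `2 Q(√(1 + x))` without, and
`-log Q(t) ~ t² / 2` gives the limit of the rate (`tendsto_noncohRate_energyRegion`). -/

namespace FadingChannel

/-! ### Relative entropy and finite-output channels -/

lemma klDiv_map_measurableEquiv {α β : Type*} [MeasurableSpace α] [MeasurableSpace β]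
    (μ ν : Measure α) [IsFiniteMeasure μ] [IsFiniteMeasure ν] (e : α ≃ᵐ β) :
    klDiv (μ.map e) (ν.map e) = klDiv μ ν := by
  refine le_antisymm (klDiv_map_le μ ν e.measurable) ?_
  have h := klDiv_map_le (μ.map e) (ν.map e) e.symm.measurable
  simpa [Measure.map_map e.symm.measurable e.measurable] using h

lemma klDiv_prod {α β : Type*} [MeasurableSpace α] [MeasurableSpace β]
    (μ μ' : Measure α) (ν ν' : Measure β) [IsProbabilityMeasure μ] [IsProbabilityMeasure μ']
    [IsProbabilityMeasure ν] [IsProbabilityMeasure ν'] :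
    klDiv (μ.prod ν) (μ'.prod ν') = klDiv μ μ' + klDiv ν ν' := by
  have h1 := klDiv_compProd_eq_add (μ := μ) (ν := μ') (κ := Kernel.const α ν)
    (η := Kernel.const α ν')
  have h2 := klDiv_compProd_left (μ := ν) (ν := ν') (κ := Kernel.const β μ)
  have h3 := klDiv_map_measurableEquiv (μ.prod ν) (μ.prod ν') MeasurableEquiv.prodComm
  simp only [Measure.compProd_const] at h1 h2
  rw [h1, ← h3]
  congr 1
  rw [← h2]
  exact congrArg₂ klDiv Measure.prod_swap Measure.prod_swap

/-- Among all product measures `J.fst.prod q`, the product of the marginals is the closest one to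
`J`. -/
lemma mutualInfo_le_klDiv_prod {α β : Type*} [MeasurableSpace α] [StandardBorelSpace α]
    [Nonempty α] [MeasurableSpace β] (J : Measure (α × β)) [IsProbabilityMeasure J]
    (q : Measure β) [IsProbabilityMeasure q] :
    mutualInfo J ≤ klDiv J (J.fst.prod q) := by
  -- the chain rule, with the output as the first coordinate
  have key : ∀ ν : Measure β, IsProbabilityMeasure ν →
      klDiv J (J.fst.prod ν) = klDiv J.snd ν +
        klDiv (J.map Prod.swap) (J.snd.prod J.fst) := by
    intro ν hν
    have h3 := klDiv_map_measurableEquiv J (J.fst.prod ν) MeasurableEquiv.prodComm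
    have h4 : (J.fst.prod ν).map (MeasurableEquiv.prodComm : α × β ≃ᵐ β × α) = ν.prod J.fst :=
      Measure.prod_swap
    have h5 : J.map (MeasurableEquiv.prodComm : α × β ≃ᵐ β × α) = J.map Prod.swap := rfl
    rw [← h3, h4, h5]
    have hd := Measure.disintegrate (J.map Prod.swap) (J.map Prod.swap).condKernel
    have hf : (J.map Prod.swap).fst = J.snd := Measure.fst_map_swap
    rw [hf] at hd
    have h1 := klDiv_compProd_eq_add (μ := J.snd) (ν := ν) (κ := (J.map Prod.swap).condKernel)
      (η := Kernel.const β J.fst)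
    simpa only [Measure.compProd_const, hd] using h1
  rw [mutualInfo, key J.snd inferInstance, key q inferInstance, klDiv_self, zero_add]
  exact le_add_self

section Finite

variable {F : Type*} [MeasurableSpace F] [MeasurableSingletonClass F] [Fintype F]

lemma withDensity_singleton_ratio {P Q : Measure F} [IsFiniteMeasure Q] (h : P ≪ Q) :
    Q.withDensity (fun y => P {y} / Q {y}) = P := by
  refine Measure.ext_of_singleton fun y => ?_
  rw [withDensity_apply _ (measurableSet_singleton y), lintegral_singleton]
  by_cases hy : Q {y} = 0
  · simp [hy, h hy]
  · exact ENNReal.div_mul_cancel hy (measure_ne_top _ _)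

/-- The relative entropy on a finite space, as a finite sum. -/
lemma klDiv_fintype {P Q : Measure F} [IsFiniteMeasure P] [IsFiniteMeasure Q] (h : P ≪ Q) :
    klDiv P Q = ∑ y, ENNReal.ofReal (Q.real {y} * klFun (P.real {y} / Q.real {y})) := by
  have hd : P.rnDeriv Q =ᵐ[Q] fun y => P {y} / Q {y} := by
    conv_lhs => rw [← withDensity_singleton_ratio h]
    exact Measure.rnDeriv_withDensity _ (measurable_of_countable _)
  rw [klDiv_eq_lintegral_klFun_of_ac h,
    lintegral_congr_ae (g := fun y => ENNReal.ofReal (klFun (P {y} / Q {y}).toReal)),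
    lintegral_fintype]
  · refine Finset.sum_congr rfl fun y _ => ?_
    rw [ENNReal.ofReal_mul measureReal_nonneg, mul_comm, measureReal_def, measureReal_def,
      ENNReal.ofReal_toReal (measure_ne_top _ _), ENNReal.toReal_div]
  · filter_upwards [hd] with y hy
    rw [hy]

/-- The divergence of the joint law of an input and the output of a finite-output channel
`x ↦ ρ.map (g (x, ·))` from a product law is the mean of the divergences of the channel laws. -/
lemma klDiv_channel_prod {α β : Type*} [MeasurableSpace α] [MeasurableSpace β]
    (μ : Measure α) (ρ : Measure β) [IsProbabilityMeasure μ] [IsProbabilityMeasure ρ]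
    {g : α × β → F} (hg : Measurable g) (ν : Measure F) [IsProbabilityMeasure ν]
    (hac : ∀ x, ρ.map (fun b => g (x, b)) ≪ ν) :
    klDiv ((μ.prod ρ).map (fun p => (p.1, g p))) (μ.prod ν) =
      ∫⁻ x, klDiv (ρ.map (fun b => g (x, b))) ν ∂μ := by
  have hgx : ∀ x, Measurable fun b => g (x, b) := fun x => hg.comp measurable_prodMk_left
  have hm : ∀ y, Measurable fun x => ρ.map (fun b => g (x, b)) {y} := by
    intro y
    have h := measurable_measure_prodMk_left (ν := ρ) (hg (measurableSet_singleton y))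
    have he : (fun x => ρ.map (fun b => g (x, b)) {y}) =
        fun x => ρ (Prod.mk x ⁻¹' (g ⁻¹' {y})) := by
      ext x
      rw [Measure.map_apply (hgx x) (measurableSet_singleton y)]
      rfl
    rw [he]
    exact h
  have hP : ∀ x, IsProbabilityMeasure (ρ.map fun b => g (x, b)) := fun x =>
    Measure.isProbabilityMeasure_map (hgx x).aemeasurable
  set f : α × F → ℝ≥0∞ := fun p => ρ.map (fun b => g (p.1, b)) {p.2} / ν {p.2} with hf
  have hfm : Measurable f := by
    refine measurable_from_prod_countable_left fun y => ?_
    exact (hm y).div_const (ν {y})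
  have hpair : Measurable fun p : α × β => (p.1, g p) := measurable_fst.prodMk hg
  have hJ : (μ.prod ρ).map (fun p => (p.1, g p)) = (μ.prod ν).withDensity f := by
    refine Measure.ext_of_lintegral _ fun φ hφ => ?_
    rw [lintegral_map hφ hpair, lintegral_prod (fun p => φ (p.1, g p)) (hφ.comp hpair).aemeasurable,
      lintegral_withDensity_eq_lintegral_mul _ hfm hφ,
      lintegral_prod _ (hfm.mul hφ).aemeasurable]
    refine lintegral_congr fun x => ?_
    have hφx : Measurable fun y => φ (x, y) := hφ.comp measurable_prodMk_left
    have h1 : ∫⁻ b, φ (x, g (x, b)) ∂ρ = ∫⁻ y, φ (x, y) ∂(ρ.map fun b => g (x, b)) :=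
      (lintegral_map hφx (hgx x)).symm
    have hd := withDensity_singleton_ratio (hac x)
    rw [h1]
    conv_lhs => rw [← hd]
    rw [lintegral_withDensity_eq_lintegral_mul _ (measurable_of_countable _) hφx]
    rfl
  have hJp : IsProbabilityMeasure ((μ.prod ν).withDensity f) :=
    hJ ▸ Measure.isProbabilityMeasure_map hpair.aemeasurable
  have hkl : Measurable fun p => ENNReal.ofReal (klFun (f p).toReal) :=
    (measurable_klFun.comp hfm.ennreal_toReal).ennreal_ofReal
  rw [hJ, klDiv_eq_lintegral_klFun_of_ac (withDensity_absolutelyContinuous _ _),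
    lintegral_congr_ae (g := fun p => ENNReal.ofReal (klFun (f p).toReal))
      (by filter_upwards [Measure.rnDeriv_withDensity (μ.prod ν) hfm] with p hp; rw [hp]),
    lintegral_prod _ hkl.aemeasurable]
  refine lintegral_congr fun x => ?_
  rw [klDiv_fintype (hac x), lintegral_fintype]
  refine Finset.sum_congr rfl fun y _ => ?_
  rw [ENNReal.ofReal_mul measureReal_nonneg, mul_comm, measureReal_def, measureReal_def,
    ENNReal.ofReal_toReal (measure_ne_top _ _), ← ENNReal.toReal_div]

/-- The mutual information between the input and the output of a finite-output channel is at most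
the mean divergence of the channel laws from any fixed output law. -/
lemma mutualInfo_channel_le {α β : Type*} [MeasurableSpace α] [StandardBorelSpace α]
    [MeasurableSpace β] (μ : Measure α) (ρ : Measure β) [IsProbabilityMeasure μ]
    [IsProbabilityMeasure ρ] {g : α × β → F} (hg : Measurable g) (ν : Measure F)
    [IsProbabilityMeasure ν] (hac : ∀ x, ρ.map (fun b => g (x, b)) ≪ ν) :
    mutualInfo ((μ.prod ρ).map (fun p => (p.1, g p))) ≤
      ∫⁻ x, klDiv (ρ.map (fun b => g (x, b))) ν ∂μ := by
  have hpair : Measurable fun p : α × β => (p.1, g p) := measurable_fst.prodMk hg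
  have : Nonempty α := μ.nonempty_of_neZero
  have hJp : IsProbabilityMeasure ((μ.prod ρ).map (fun p => (p.1, g p))) :=
    Measure.isProbabilityMeasure_map hpair.aemeasurable
  have hfst : ((μ.prod ρ).map (fun p => (p.1, g p))).fst = μ := by
    rw [Measure.fst_map_prodMk hg]
    exact Measure.fst_prod
  have h := mutualInfo_le_klDiv_prod ((μ.prod ρ).map (fun p => (p.1, g p))) ν
  rwa [hfst, klDiv_channel_prod μ ρ hg ν hac] at h

/-- The law that gives mass `δ` to `P` and mass `1 - δ` to `Q`. -/
noncomputable def mixture {α : Type*} [MeasurableSpace α] (δ : ℝ) (P Q : Measure α) : Measure α :=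
  ENNReal.ofReal (1 - δ) • Q + ENNReal.ofReal δ • P

lemma isProbabilityMeasure_mixture {α : Type*} [MeasurableSpace α] {δ : ℝ} (h0 : 0 ≤ δ)
    (h1 : δ ≤ 1) (P Q : Measure α) [IsProbabilityMeasure P] [IsProbabilityMeasure Q] :
    IsProbabilityMeasure (mixture δ P Q) := by
  constructor
  simp only [mixture, Measure.add_apply, Measure.smul_apply, measure_univ, smul_eq_mul, mul_one]
  rw [← ENNReal.ofReal_add (by linarith) h0]
  simp

lemma absolutelyContinuous_mixture {α : Type*} [MeasurableSpace α] {δ : ℝ}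
    (h1 : δ < 1) (P Q : Measure α) : Q ≪ mixture δ P Q := by
  intro s hs
  simp only [mixture, Measure.add_apply, Measure.smul_apply, smul_eq_mul, add_eq_zero,
    mul_eq_zero, ENNReal.ofReal_eq_zero] at hs
  rcases hs.1 with h | h
  · linarith
  · exact h

/-- The information conveyed by an input that equals `x` with probability `δ`, and `x₀`
otherwise. -/
lemma le_mutualInfo_onOff {α β : Type*} [MeasurableSpace α]
    [MeasurableSingletonClass α] [MeasurableSpace β] (ρ : Measure β) [IsProbabilityMeasure ρ]
    {g : α × β → F} (hg : Measurable g)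
    {δ : ℝ} (h0 : 0 ≤ δ) (h1 : δ < 1) (x x₀ : α)
    (hac : ∀ x, ρ.map (fun b => g (x, b)) ≪ ρ.map (fun b => g (x₀, b))) :
    ENNReal.ofReal δ * klDiv (ρ.map (fun b => g (x, b)))
        (mixture δ (ρ.map (fun b => g (x, b))) (ρ.map (fun b => g (x₀, b)))) ≤
      mutualInfo (((mixture δ (Measure.dirac x) (Measure.dirac x₀)).prod ρ).map
        (fun p => (p.1, g p))) := by
  set μ := mixture δ (Measure.dirac x) (Measure.dirac x₀) with hμ
  have hμp : IsProbabilityMeasure μ := isProbabilityMeasure_mixture h0 h1.le _ _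
  have hgx : ∀ x, Measurable fun b => g (x, b) := fun x => hg.comp measurable_prodMk_left
  have hP : ∀ x, IsProbabilityMeasure (ρ.map fun b => g (x, b)) := fun x =>
    Measure.isProbabilityMeasure_map (hgx x).aemeasurable
  have hfst : ((μ.prod ρ).map (fun p => (p.1, g p))).fst = μ := by
    rw [Measure.fst_map_prodMk hg]
    exact Measure.fst_prod
  have hsnd : ((μ.prod ρ).map (fun p => (p.1, g p))).snd =
      mixture δ (ρ.map (fun b => g (x, b))) (ρ.map (fun b => g (x₀, b))) := by
    rw [Measure.snd_map_prodMk measurable_fst, hμ, mixture, mixture, Measure.add_prod,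
      Measure.prod_smul_left, Measure.prod_smul_left, Measure.dirac_prod, Measure.dirac_prod,
      Measure.map_add _ _ hg, Measure.map_smul, Measure.map_smul,
      Measure.map_map hg measurable_prodMk_left, Measure.map_map hg measurable_prodMk_left]
    rfl
  have hmix := isProbabilityMeasure_mixture h0 h1.le (ρ.map (fun b => g (x, b)))
    (ρ.map (fun b => g (x₀, b)))
  rw [mutualInfo, hfst, hsnd, klDiv_channel_prod μ ρ hg _
    fun x' => (hac x').trans (absolutelyContinuous_mixture h1 _ _)]
  conv_rhs => rw [hμ, mixture]
  rw [lintegral_add_measure, lintegral_smul_measure, lintegral_smul_measure, smul_eq_mul,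
    smul_eq_mul]
  refine le_trans ?_ le_add_self
  rw [lintegral_dirac]

lemma mixture_real {α : Type*} [MeasurableSpace α] {δ : ℝ} (h0 : 0 ≤ δ) (h1 : δ ≤ 1)
    (P Q : Measure α) [IsFiniteMeasure P] [IsFiniteMeasure Q] (s : Set α) :
    (mixture δ P Q).real s = (1 - δ) * Q.real s + δ * P.real s := by
  simp only [mixture, measureReal_def, Measure.add_apply, Measure.smul_apply, smul_eq_mul]
  rw [ENNReal.toReal_add (by finiteness) (by finiteness), ENNReal.toReal_mul,
    ENNReal.toReal_mul, ENNReal.toReal_ofReal (by linarith), ENNReal.toReal_ofReal h0]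

/-- Relative entropy on a finite space is continuous along mixtures. -/
lemma tendsto_klDiv_mixture {P Q : Measure F} [IsProbabilityMeasure P] [IsProbabilityMeasure Q]
    (h : P ≪ Q) {δ : ℕ → ℝ} (h0 : ∀ n, 0 ≤ δ n) (h1 : ∀ n, δ n < 1)
    (hδ : Tendsto δ atTop (𝓝 0)) :
    Tendsto (fun n => klDiv P (mixture (δ n) P Q)) atTop (𝓝 (klDiv P Q)) := by
  have hp := fun n => isProbabilityMeasure_mixture (h0 n) (h1 n).le P Q
  simp_rw [fun n => klDiv_fintype (h.trans (absolutelyContinuous_mixture (h1 n) P Q)),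
    klDiv_fintype h]
  refine tendsto_finsetSum _ fun y _ => (ENNReal.continuous_ofReal.tendsto _).comp ?_
  simp_rw [fun n => mixture_real (h0 n) (h1 n).le P Q]
  have hlim : Tendsto (fun n => (1 - δ n) * Q.real {y} + δ n * P.real {y}) atTop
      (𝓝 (Q.real {y})) := by
    have := ((tendsto_const_nhds (x := (1 : ℝ))).sub hδ).mul_const (Q.real {y}) |>.add
      (hδ.mul_const (P.real {y}))
    simpa using this
  by_cases hy : Q {y} = 0
  · have hP : P.real {y} = 0 := by simp [measureReal_def, h hy]
    have hQ : Q.real {y} = 0 := by simp [measureReal_def, hy]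
    simp [hP, hQ]
  · have hQ : Q.real {y} ≠ 0 := by
      rw [measureReal_def]; exact (ENNReal.toReal_ne_zero.2 ⟨hy, measure_ne_top _ _⟩)
    exact hlim.mul ((continuous_klFun.tendsto _).comp (tendsto_const_nhds.div hlim hQ))

end Finite

/-! ### Relative entropy of real Gaussian laws -/

/-- The logarithm of the density of `gaussianReal m v` with respect to `gaussianReal 0 w`. -/
noncomputable def gaussianLogRatio (m : ℝ) (v w : ℝ≥0) (x : ℝ) : ℝ :=
  Real.log (w / v) / 2 - (x - m) ^ 2 / (2 * v) + x ^ 2 / (2 * w)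

lemma measurable_gaussianLogRatio (m : ℝ) (v w : ℝ≥0) : Measurable (gaussianLogRatio m v w) := by
  unfold gaussianLogRatio
  fun_prop

lemma gaussianReal_eq_withDensity (m : ℝ) {v w : ℝ≥0} (hv : v ≠ 0) (hw : w ≠ 0) :
    gaussianReal m v = (gaussianReal 0 w).withDensity
      (fun x => ENNReal.ofReal (Real.exp (gaussianLogRatio m v w x))) := by
  have hl := measurable_gaussianLogRatio m v w
  rw [gaussianReal_of_var_ne_zero _ hv, gaussianReal_of_var_ne_zero _ hw,
    ← withDensity_mul _ (measurable_gaussianPDF 0 w) (by fun_prop)]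
  congr 1
  ext x
  have hv' : (0 : ℝ) < v := by positivity
  have hw' : (0 : ℝ) < w := by positivity
  have hs : (√(2 * Real.pi * v))⁻¹ =
      (√(2 * Real.pi * w))⁻¹ * Real.exp (Real.log (w / v) / 2) := by
    rw [← Real.log_sqrt (by positivity), Real.exp_log (by positivity), Real.sqrt_div (by positivity),
      Real.sqrt_mul (x := 2 * Real.pi) (by positivity), Real.sqrt_mul (x := 2 * Real.pi)
      (by positivity)]
    have := Real.sqrt_pos.2 hw'
    field_simp
  simp only [gaussianPDF, Pi.mul_apply, gaussianLogRatio]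
  rw [← ENNReal.ofReal_mul (gaussianPDFReal_nonneg _ _ _)]
  simp only [gaussianPDFReal, hs]
  rw [mul_assoc (√(2 * Real.pi * w))⁻¹, mul_assoc (√(2 * Real.pi * w))⁻¹, ← Real.exp_add,
    ← Real.exp_add]
  congr 3
  ring

lemma integrable_sq_gaussianReal (m : ℝ) (v : ℝ≥0) :
    Integrable (fun x => x ^ 2) (gaussianReal m v) :=
  (memLp_id_gaussianReal (μ := m) (v := v) 2).integrable_sq

lemma integrable_id_gaussianReal (m : ℝ) (v : ℝ≥0) :
    Integrable (fun x => x) (gaussianReal m v) :=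
  (memLp_id_gaussianReal (μ := m) (v := v) 1).integrable le_rfl

lemma integral_sq_gaussianReal (m : ℝ) (v : ℝ≥0) :
    ∫ x, x ^ 2 ∂gaussianReal m v = v + m ^ 2 := by
  have h := variance_eq_sub (memLp_id_gaussianReal (μ := m) (v := v) 2)
  rw [variance_id_gaussianReal] at h
  simp only [Pi.pow_apply, id] at h
  rw [integral_id_gaussianReal] at h
  linarith

lemma integrable_gaussianLogRatio (m : ℝ) (v w : ℝ≥0) :
    Integrable (gaussianLogRatio m v w) (gaussianReal m v) := by
  have h1 := integrable_sq_gaussianReal m v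
  have h2 := integrable_id_gaussianReal m v
  have : gaussianLogRatio m v w = fun x => (Real.log (w / v) / 2 - m ^ 2 / (2 * v)) +
      x * (m / v) + x ^ 2 * (1 / (2 * w) - 1 / (2 * v)) := by
    ext x
    by_cases hv : (v : ℝ) = 0
    · simp [gaussianLogRatio, hv]; ring
    · simp only [gaussianLogRatio]; field_simp; ring
  rw [this]
  exact ((integrable_const _).add (h2.mul_const _)).add (h1.mul_const _)

lemma integral_gaussianLogRatio (m : ℝ) {v w : ℝ≥0} (hv : v ≠ 0) :
    ∫ x, gaussianLogRatio m v w x ∂gaussianReal m v =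
      Real.log (w / v) / 2 - 1 / 2 + (v + m ^ 2) / (2 * w) := by
  have h1 := integrable_sq_gaussianReal m v
  have h2 := integrable_id_gaussianReal m v
  have hv' : (v : ℝ) ≠ 0 := by exact_mod_cast hv
  have : gaussianLogRatio m v w = fun x => (Real.log (w / v) / 2 - m ^ 2 / (2 * v)) +
      x * (m / v) + x ^ 2 * (1 / (2 * w) - 1 / (2 * v)) := by
    ext x
    simp only [gaussianLogRatio]; field_simp; ring
  have h2' : Integrable (fun x => (Real.log (w / v) / 2 - m ^ 2 / (2 * v)) + x * (m / v))
      (gaussianReal m v) := (integrable_const _).add (h2.mul_const _)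
  rw [this, integral_add h2' (h1.mul_const _), integral_add (integrable_const _) (h2.mul_const _),
    integral_mul_const, integral_mul_const,
    integral_sq_gaussianReal, integral_id_gaussianReal]
  simp only [integral_const, probReal_univ, smul_eq_mul]
  field_simp
  ring

lemma llr_withDensity_exp {α : Type*} [MeasurableSpace α] (ν : Measure α) [SigmaFinite ν]
    {l : α → ℝ} (hl : Measurable l) :
    llr (ν.withDensity fun x => ENNReal.ofReal (Real.exp (l x))) ν =ᵐ[ν] l := by
  filter_upwards [Measure.rnDeriv_withDensity ν
    (f := fun x => ENNReal.ofReal (Real.exp (l x))) (by fun_prop)] with x hx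
  rw [llr, hx, ENNReal.toReal_ofReal (Real.exp_pos _).le, Real.log_exp]

lemma gaussianReal_ac (m : ℝ) {v w : ℝ≥0} (hv : v ≠ 0) (hw : w ≠ 0) :
    gaussianReal m v ≪ gaussianReal 0 w := by
  rw [gaussianReal_eq_withDensity m hv hw]
  exact withDensity_absolutelyContinuous _ _

lemma llr_gaussianReal_restrict (m : ℝ) {v w : ℝ≥0} (hv : v ≠ 0) (hw : w ≠ 0) {S : Set ℝ}
    (hS : MeasurableSet S) :
    llr ((gaussianReal m v).restrict S) ((gaussianReal 0 w).restrict S)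
      =ᵐ[(gaussianReal m v).restrict S] gaussianLogRatio m v w := by
  refine ((gaussianReal_ac m hv hw).restrict S).ae_eq ?_
  have h := llr_withDensity_exp ((gaussianReal 0 w).restrict S)
    (measurable_gaussianLogRatio m v w)
  rwa [← restrict_withDensity hS, ← gaussianReal_eq_withDensity m hv hw] at h

lemma klDiv_gaussianReal (m : ℝ) {v w : ℝ≥0} (hv : v ≠ 0) (hw : w ≠ 0) :
    klDiv (gaussianReal m v) (gaussianReal 0 w) =
      ENNReal.ofReal (Real.log (w / v) / 2 - 1 / 2 + (v + m ^ 2) / (2 * w)) := by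
  have h := llr_gaussianReal_restrict m hv hw MeasurableSet.univ
  simp only [Measure.restrict_univ] at h
  rw [klDiv_of_ac_of_integrable (gaussianReal_ac m hv hw)
    ((integrable_congr h).2 (integrable_gaussianLogRatio m v w)), integral_congr_ae h,
    integral_gaussianLogRatio m hv]
  simp

/-- The contribution of one cell `S` of a quantizer to the relative entropy is at most the integral
of the log-likelihood ratio over the cell (Jensen's inequality). -/
lemma gaussian_cell_le (m : ℝ) {v w : ℝ≥0} (hv : v ≠ 0) (hw : w ≠ 0) {S : Set ℝ}
    (hS : MeasurableSet S) :
    (gaussianReal 0 w).real S * klFun ((gaussianReal m v).real S / (gaussianReal 0 w).real S) ≤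
      ∫ x in S, gaussianLogRatio m v w x ∂gaussianReal m v + (gaussianReal 0 w).real S -
        (gaussianReal m v).real S := by
  have h := llr_gaussianReal_restrict m hv hw hS
  have hac := (gaussianReal_ac m hv hw).restrict S
  have hint := (integrable_congr h).2 (integrable_gaussianLogRatio m v w).integrableOn
  have := mul_klFun_le_toReal_klDiv hac hint
  rw [toReal_klDiv hac hint, integral_congr_ae h] at this
  simpa [measureReal_restrict_apply MeasurableSet.univ] using this

/-! ### Circularly-symmetric Gaussian laws and their quantization -/

/-- The law of `U + i V` for independent real random variables `U`, `V` with laws `μ`, `ν`. -/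
noncomputable def complexProd (μ ν : Measure ℝ) : Measure ℂ :=
  (μ.prod ν).map (fun p => (⟨p.1, p.2⟩ : ℂ))

lemma measurable_complexMk : Measurable (fun p : ℝ × ℝ => (⟨p.1, p.2⟩ : ℂ)) :=
  Complex.measurableEquivRealProd.symm.measurable

instance (μ ν : Measure ℝ) [IsProbabilityMeasure μ] [IsProbabilityMeasure ν] :
    IsProbabilityMeasure (complexProd μ ν) :=
  Measure.isProbabilityMeasure_map measurable_complexMk.aemeasurable

lemma klDiv_complexProd (μ ν μ' ν' : Measure ℝ) [IsProbabilityMeasure μ] [IsProbabilityMeasure ν]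
    [IsProbabilityMeasure μ'] [IsProbabilityMeasure ν'] :
    klDiv (complexProd μ ν) (complexProd μ' ν') = klDiv μ μ' + klDiv ν ν' := by
  rw [← klDiv_prod]
  exact klDiv_map_measurableEquiv (μ.prod ν) (μ'.prod ν') Complex.measurableEquivRealProd.symm

open scoped Classical in
/-- The one-bit quantization of the law `μ`. -/
noncomputable def bitLaw (S : Set ℝ) (μ : Measure ℝ) : Measure Bool :=
  μ.map (fun u => decide (u ∈ S))

open scoped Classical in
lemma measurable_decide_mem {S : Set ℝ} (hS : MeasurableSet S) :
    Measurable (fun u => decide (u ∈ S)) := by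
  refine measurable_to_bool ?_
  convert! hS
  ext; simp

lemma isProbabilityMeasure_bitLaw {S : Set ℝ} (hS : MeasurableSet S) (μ : Measure ℝ)
    [IsProbabilityMeasure μ] : IsProbabilityMeasure (bitLaw S μ) :=
  Measure.isProbabilityMeasure_map (measurable_decide_mem hS).aemeasurable

lemma measurable_quantize {A B : Set ℝ} (hA : MeasurableSet A) (hB : MeasurableSet B) :
    Measurable (quantize A B) :=
  ((measurable_decide_mem hA).comp Complex.measurable_re).prodMk
    ((measurable_decide_mem hB).comp Complex.measurable_im)

lemma map_quantize_complexProd {A B : Set ℝ} (hA : MeasurableSet A) (hB : MeasurableSet B)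
    (μ ν : Measure ℝ) [IsProbabilityMeasure μ] [IsProbabilityMeasure ν] :
    (complexProd μ ν).map (quantize A B) = (bitLaw A μ).prod (bitLaw B ν) := by
  rw [complexProd, Measure.map_map (measurable_quantize hA hB) measurable_complexMk, bitLaw, bitLaw,
    Measure.map_prod_map _ _ (measurable_decide_mem hA) (measurable_decide_mem hB)]
  rfl

lemma bitLaw_real_true {S : Set ℝ} (hS : MeasurableSet S) (μ : Measure ℝ) :
    (bitLaw S μ).real {true} = μ.real S := by
  rw [bitLaw, measureReal_def, Measure.map_apply (measurable_decide_mem hS) (by simp)]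
  simp [measureReal_def, preimage]

lemma bitLaw_real_false {S : Set ℝ} (hS : MeasurableSet S) (μ : Measure ℝ) :
    (bitLaw S μ).real {false} = μ.real Sᶜ := by
  rw [bitLaw, measureReal_def, Measure.map_apply (measurable_decide_mem hS) (by simp)]
  simp [measureReal_def, preimage, compl_def]

lemma klDiv_bitLaw {S : Set ℝ} (hS : MeasurableSet S) {μ ν : Measure ℝ} [IsProbabilityMeasure μ]
    [IsProbabilityMeasure ν] (h : μ ≪ ν) :
    klDiv (bitLaw S μ) (bitLaw S ν) = ENNReal.ofReal (ν.real S * klFun (μ.real S / ν.real S) +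
      ν.real Sᶜ * klFun (μ.real Sᶜ / ν.real Sᶜ)) := by
  have := isProbabilityMeasure_bitLaw hS μ
  have := isProbabilityMeasure_bitLaw hS ν
  have hac : bitLaw S μ ≪ bitLaw S ν := h.map (measurable_decide_mem hS)
  rw [klDiv_fintype hac, Fintype.sum_bool, bitLaw_real_true hS,
    bitLaw_real_false hS, bitLaw_real_true hS, bitLaw_real_false hS, ENNReal.ofReal_add]
  all_goals exact mul_nonneg measureReal_nonneg (klFun_nonneg (by positivity))

lemma circGaussian_eq (v : ℝ≥0) :
    circGaussian v = complexProd (gaussianReal 0 (v / 2)) (gaussianReal 0 (v / 2)) := rfl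

instance (v : ℝ≥0) : IsProbabilityMeasure (circGaussian v) := by
  rw [circGaussian_eq]; infer_instance

instance : IsProbabilityMeasure fadingLaw := by unfold fadingLaw; infer_instance

instance (σ : ℝ) : IsProbabilityMeasure (noiseLaw σ) := by unfold noiseLaw; infer_instance

lemma map_const_add_circGaussian (v : ℝ≥0) (c : ℂ) :
    (circGaussian v).map (fun z => c + z) =
      complexProd (gaussianReal c.re (v / 2)) (gaussianReal c.im (v / 2)) := by
  have h1 := gaussianReal_map_const_add (μ := 0) (v := v / 2) c.re
  have h2 := gaussianReal_map_const_add (μ := 0) (v := v / 2) c.im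
  rw [zero_add] at h1 h2
  rw [← h1, ← h2, circGaussian_eq, complexProd, complexProd,
    Measure.map_prod_map _ _ (by fun_prop) (by fun_prop),
    Measure.map_map (by fun_prop) measurable_complexMk,
    Measure.map_map measurable_complexMk (by fun_prop)]
  rfl

lemma charFun_circGaussian (v : ℝ≥0) (t : ℂ) :
    charFun (circGaussian v) t = Complex.exp (-(v * ‖t‖ ^ 2 / 4 : ℝ)) := by
  have h1 := charFun_gaussianReal (μ := 0) (v := v / 2) t.re
  have h2 := charFun_gaussianReal (μ := 0) (v := v / 2) t.im
  rw [charFun_apply] at h1 h2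
  rw [charFun_apply, circGaussian_eq, complexProd, integral_map measurable_complexMk.aemeasurable
    (by fun_prop)]
  have : ∀ p : ℝ × ℝ, Complex.exp (inner ℝ (⟨p.1, p.2⟩ : ℂ) t * Complex.I) =
      Complex.exp (inner ℝ p.1 t.re * Complex.I) * Complex.exp (inner ℝ p.2 t.im * Complex.I) := by
    intro p
    rw [← Complex.exp_add]
    congr 1
    simp [Complex.inner]
    ring
  simp_rw [this]
  rw [integral_prod_mul (fun x : ℝ => Complex.exp (inner ℝ x t.re * Complex.I))
    (fun y : ℝ => Complex.exp (inner ℝ y t.im * Complex.I)), h1, h2, ← Complex.exp_add]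
  congr 1
  rw [Complex.sq_norm, Complex.normSq_apply]
  push_cast
  ring

/-- A circularly-symmetric Gaussian multiplied by `x`, plus an independent one. -/
lemma map_mul_add_circGaussian (v w u : ℝ≥0) (x : ℂ) (hu : (u : ℝ) = v * ‖x‖ ^ 2 + w) :
    ((circGaussian v).prod (circGaussian w)).map (fun p => p.1 * x + p.2) = circGaussian u := by
  have : IsProbabilityMeasure
      (((circGaussian v).prod (circGaussian w)).map (fun p => p.1 * x + p.2)) :=
    Measure.isProbabilityMeasure_map (by fun_prop)
  refine Measure.ext_of_charFun ?_
  ext t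
  rw [charFun_circGaussian, charFun_apply, integral_map (by fun_prop) (by fun_prop)]
  have h1 := charFun_circGaussian v (t * (starRingEnd ℂ) x)
  have h2 := charFun_circGaussian w t
  rw [charFun_apply] at h1 h2
  have : ∀ p : ℂ × ℂ, Complex.exp (inner ℝ (p.1 * x + p.2) t * Complex.I) =
      Complex.exp (inner ℝ p.1 (t * (starRingEnd ℂ) x) * Complex.I) *
        Complex.exp (inner ℝ p.2 t * Complex.I) := by
    intro p
    rw [← Complex.exp_add]
    congr 1
    simp [Complex.inner]
    ring
  simp_rw [this]
  rw [integral_prod_mul (fun z : ℂ => Complex.exp (inner ℝ z (t * (starRingEnd ℂ) x) * Complex.I))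
    (fun z : ℂ => Complex.exp (inner ℝ z t * Complex.I)), h1, h2, ← Complex.exp_add]
  congr 1
  rw [hu, norm_mul, RCLike.norm_conj]
  push_cast
  ring

/-! ### The coherent channel: upper bounds, and capacity versus rate -/

/-- The variance of each of the two components of the noise. -/
noncomputable def noiseVar (σ : ℝ) : ℝ≥0 := Real.toNNReal (σ ^ 2) / 2

lemma coe_noiseVar (σ : ℝ) : (noiseVar σ : ℝ) = σ ^ 2 / 2 := by
  simp [noiseVar, Real.coe_toNNReal _ (sq_nonneg σ)]

lemma noiseVar_ne_zero {σ : ℝ} (hσ : 0 < σ) : noiseVar σ ≠ 0 := by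
  have h := coe_noiseVar σ
  intro h0
  rw [h0] at h
  have : 0 < σ ^ 2 := by positivity
  simp at h
  linarith

lemma map_const_add_noiseLaw (σ : ℝ) (c : ℂ) :
    (noiseLaw σ).map (fun z => c + z) =
      complexProd (gaussianReal c.re (noiseVar σ)) (gaussianReal c.im (noiseVar σ)) :=
  map_const_add_circGaussian _ c

lemma ofReal_norm_sq (x : ℂ) : ENNReal.ofReal (‖x‖ ^ 2) = ‖x‖ₑ ^ 2 := by
  rw [ENNReal.ofReal_pow (norm_nonneg x), ofReal_norm]

lemma klDiv_shifted_noise {σ : ℝ} (hσ : 0 < σ) (c : ℂ) :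
    klDiv ((noiseLaw σ).map (fun z => c + z)) ((noiseLaw σ).map (fun z => 0 + z)) =
      ENNReal.ofReal (1 / σ ^ 2) * ‖c‖ₑ ^ 2 := by
  have hs := noiseVar_ne_zero hσ
  have hs' : (noiseVar σ : ℝ) ≠ 0 := by exact_mod_cast hs
  rw [map_const_add_noiseLaw, map_const_add_noiseLaw, klDiv_complexProd, Complex.zero_re,
    Complex.zero_im, klDiv_gaussianReal _ hs hs, klDiv_gaussianReal _ hs hs]
  have h : ∀ m : ℝ, Real.log (noiseVar σ / noiseVar σ) / 2 - 1 / 2 +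
      (noiseVar σ + m ^ 2) / (2 * noiseVar σ) = m ^ 2 / σ ^ 2 := by
    intro m
    rw [div_self hs', Real.log_one]
    have := coe_noiseVar σ
    have h2 : σ ^ 2 = 2 * noiseVar σ := by rw [this]; ring
    rw [h2]
    field_simp
    ring
  rw [h, h, ← ENNReal.ofReal_add (by positivity) (by positivity), ← ofReal_norm_sq,
    ← ENNReal.ofReal_mul (by positivity), Complex.sq_norm, Complex.normSq_apply]
  congr 1
  ring

section Coherent

variable {σ : ℝ} {A B : ℂ → Set ℝ}

lemma IsBorelFamily.measurableSet (hA : IsBorelFamily A) (h : ℂ) : MeasurableSet (A h) :=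
  measurable_prodMk_left (x := h) hA

lemma cohOutput_eq_map (hA : IsBorelFamily A) (hB : IsBorelFamily B) (h x : ℂ) :
    cohOutput σ A B h x =
      ((noiseLaw σ).map (fun z => h * x + z)).map (quantize (A h) (B h)) := by
  rw [Measure.map_map (measurable_quantize (hA.measurableSet h) (hB.measurableSet h))
    (by fun_prop)]
  rfl

lemma cohOutput_eq_prod (hA : IsBorelFamily A) (hB : IsBorelFamily B) (h x : ℂ) :
    cohOutput σ A B h x = (bitLaw (A h) (gaussianReal (h * x).re (noiseVar σ))).prod
      (bitLaw (B h) (gaussianReal (h * x).im (noiseVar σ))) := by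
  rw [cohOutput_eq_map hA hB, map_const_add_noiseLaw,
    map_quantize_complexProd (hA.measurableSet h) (hB.measurableSet h)]

lemma isProbabilityMeasure_cohOutput (hA : IsBorelFamily A) (hB : IsBorelFamily B) (h x : ℂ) :
    IsProbabilityMeasure (cohOutput σ A B h x) := by
  rw [cohOutput_eq_map hA hB]
  have := Measure.isProbabilityMeasure_map (μ := noiseLaw σ) (f := fun z => h * x + z)
    (by fun_prop)
  exact Measure.isProbabilityMeasure_map
    (measurable_quantize (hA.measurableSet h) (hB.measurableSet h)).aemeasurable

lemma klDiv_cohOutput_le (hσ : 0 < σ) (hA : IsBorelFamily A) (hB : IsBorelFamily B) (h x : ℂ) :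
    klDiv (cohOutput σ A B h x) (cohOutput σ A B h 0) ≤
      ENNReal.ofReal (1 / σ ^ 2) * (‖h‖ₑ ^ 2 * ‖x‖ₑ ^ 2) := by
  rw [cohOutput_eq_map hA hB, cohOutput_eq_map hA hB, mul_zero, ← mul_pow, ← enorm_mul,
    ← klDiv_shifted_noise hσ]
  have h1 := Measure.isProbabilityMeasure_map (μ := noiseLaw σ) (f := fun z => h * x + z)
    (by fun_prop)
  have h2 := Measure.isProbabilityMeasure_map (μ := noiseLaw σ) (f := fun z => 0 + z)
    (by fun_prop)
  exact klDiv_map_le _ _ (measurable_quantize (hA.measurableSet h) (hB.measurableSet h))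

lemma cohOutput_ac (hσ : 0 < σ) (hA : IsBorelFamily A) (hB : IsBorelFamily B) (h x : ℂ) :
    cohOutput σ A B h x ≪ cohOutput σ A B h 0 :=
  (klDiv_ne_top_iff.1 ((klDiv_cohOutput_le hσ hA hB h x).trans_lt (by finiteness)).ne).1

lemma integrable_sq_norm_fading : Integrable (fun h : ℂ => ‖h‖ ^ 2) fadingLaw ∧
    ∫ h, ‖h‖ ^ 2 ∂fadingLaw = 1 := by
  have hi := integrable_sq_gaussianReal 0 (1 / 2)
  have he : (fun h : ℂ => ‖h‖ ^ 2) = fun h => h.re ^ 2 + h.im ^ 2 := by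
    ext h
    rw [Complex.sq_norm, Complex.normSq_apply]
    ring
  have h1 : Integrable (fun p : ℝ × ℝ => p.1 ^ 2)
      ((gaussianReal 0 (1 / 2)).prod (gaussianReal 0 (1 / 2))) := hi.comp_fst _
  have h2 : Integrable (fun p : ℝ × ℝ => p.2 ^ 2)
      ((gaussianReal 0 (1 / 2)).prod (gaussianReal 0 (1 / 2))) := hi.comp_snd _
  rw [he, fadingLaw, circGaussian]
  constructor
  · rw [integrable_map_measure (by fun_prop) measurable_complexMk.aemeasurable]
    exact h1.add h2
  · rw [integral_map measurable_complexMk.aemeasurable (by fun_prop), integral_add h1 h2,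
      integral_fun_fst (fun x : ℝ => x ^ 2), integral_fun_snd (fun x : ℝ => x ^ 2),
      integral_sq_gaussianReal]
    simp
    norm_num

lemma lintegral_enorm_sq_fading : ∫⁻ h, ‖h‖ₑ ^ 2 ∂fadingLaw = 1 := by
  simp_rw [← ofReal_norm_sq]
  rw [← ofReal_integral_eq_lintegral_ofReal integrable_sq_norm_fading.1
    (ae_of_all _ fun _ => by positivity), integrable_sq_norm_fading.2, ENNReal.ofReal_one]

lemma cohRate_le (hσ : 0 < σ) (hA : IsBorelFamily A) (hB : IsBorelFamily B) (ξ : ℂ) :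
    cohRate σ A B ξ ≤ ENNReal.ofReal (1 / σ ^ 2) := by
  refine ENNReal.div_le_of_le_mul ?_
  calc _ ≤ ∫⁻ h, ENNReal.ofReal (1 / σ ^ 2) * (‖h‖ₑ ^ 2 * ‖ξ‖ₑ ^ 2) ∂fadingLaw :=
        lintegral_mono fun h => klDiv_cohOutput_le hσ hA hB h ξ
    _ = _ := by
        rw [lintegral_const_mul _ (by fun_prop), lintegral_mul_const _ (by fun_prop),
          lintegral_enorm_sq_fading, one_mul]

lemma measurable_channel_coh (hA : IsBorelFamily A) (hB : IsBorelFamily B) (h : ℂ) :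
    Measurable fun p : ℂ × ℂ => quantize (A h) (B h) (h * p.1 + p.2) :=
  (measurable_quantize (hA.measurableSet h) (hB.measurableSet h)).comp (by fun_prop)

lemma cohInfo_le (hσ : 0 < σ) (hA : IsBorelFamily A) (hB : IsBorelFamily B) {P : ℝ}
    {μ : Measure ℂ} (hμ : IsAdmissibleInput P μ) :
    cohInfo σ A B μ ≤ ENNReal.ofReal (1 / σ ^ 2) * ENNReal.ofReal P := by
  have := hμ.1
  calc cohInfo σ A B μ
      ≤ ∫⁻ h, ∫⁻ x, klDiv (cohOutput σ A B h x) (cohOutput σ A B h 0) ∂μ ∂fadingLaw :=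
        lintegral_mono fun h => by
          have := isProbabilityMeasure_cohOutput (σ := σ) hA hB h 0
          exact mutualInfo_channel_le μ (noiseLaw σ) (measurable_channel_coh hA hB h) _
            (cohOutput_ac hσ hA hB h)
    _ ≤ ∫⁻ h, ∫⁻ x, ENNReal.ofReal (1 / σ ^ 2) * (‖h‖ₑ ^ 2 * ‖x‖ₑ ^ 2) ∂μ ∂fadingLaw :=
        lintegral_mono fun h => lintegral_mono fun x => klDiv_cohOutput_le hσ hA hB h x
    _ = ENNReal.ofReal (1 / σ ^ 2) * ∫⁻ x, ‖x‖ₑ ^ 2 ∂μ := by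
        simp_rw [fun h : ℂ => lintegral_const_mul (μ := μ) (ENNReal.ofReal (1 / σ ^ 2))
            (f := fun x : ℂ => ‖h‖ₑ ^ 2 * ‖x‖ₑ ^ 2) (by fun_prop),
          fun h : ℂ => lintegral_const_mul (μ := μ) (‖h‖ₑ ^ 2)
            (f := fun x : ℂ => ‖x‖ₑ ^ 2) (by fun_prop)]
        rw [lintegral_const_mul _ (by fun_prop), lintegral_mul_const _ (by fun_prop),
          lintegral_enorm_sq_fading, one_mul]
    _ ≤ _ := by gcongr; exact hμ.2

lemma cohCapacityPerEnergy_le (hσ : 0 < σ) :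
    cohCapacityPerEnergy σ ≤ ENNReal.ofReal (1 / σ ^ 2) := by
  refine iSup₂_le fun P _ => ENNReal.div_le_of_le_mul ?_
  exact iSup_le fun A => iSup_le fun B => iSup_le fun μ => iSup_le fun hA => iSup_le fun hB =>
    iSup_le fun hμ => cohInfo_le hσ hA hB hμ

end Coherent

/-- The input that equals `ξ` with probability `δ`, and `0` otherwise, has energy `δ |ξ|²`. -/
lemma isAdmissibleInput_onOff {δ : ℝ} (h0 : 0 ≤ δ) (h1 : δ ≤ 1) (ξ : ℂ) :
    IsAdmissibleInput (δ * ‖ξ‖ ^ 2) (mixture δ (Measure.dirac ξ) (Measure.dirac 0)) := by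
  refine ⟨isProbabilityMeasure_mixture h0 h1 _ _, ?_⟩
  rw [mixture, lintegral_add_measure, lintegral_smul_measure, lintegral_smul_measure,
    lintegral_dirac, lintegral_dirac, ENNReal.ofReal_mul h0, ofReal_norm_sq]
  simp

/-- The probabilities of the symbol `ξ` in a sequence of on-off inputs of vanishing energy. -/
noncomputable def onOffProb (n : ℕ) : ℝ := 1 / ((n : ℝ) + 2)

lemma onOffProb_pos (n : ℕ) : 0 < onOffProb n := by unfold onOffProb; positivity

lemma onOffProb_lt_one (n : ℕ) : onOffProb n < 1 := by
  unfold onOffProb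
  rw [div_lt_one (by positivity)]
  have : (0 : ℝ) ≤ n := by positivity
  linarith

lemma tendsto_onOffProb : Tendsto onOffProb atTop (𝓝 0) :=
  tendsto_const_nhds.div_atTop (tendsto_natCast_atTop_atTop.atTop_add tendsto_const_nhds)

section CoherentLower

variable {σ : ℝ} {A B : ℂ → Set ℝ}

lemma cohInfo_le_capacityPerEnergy (hA : IsBorelFamily A) (hB : IsBorelFamily B) {P : ℝ}
    (hP : 0 < P) {μ : Measure ℂ} (hμ : IsAdmissibleInput P μ) :
    cohInfo σ A B μ ≤ cohCapacityPerEnergy σ * ENNReal.ofReal P := by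
  have h1 : cohInfo σ A B μ ≤ cohCapacity σ P :=
    le_iSup_of_le A <| le_iSup_of_le B <| le_iSup_of_le μ <| le_iSup_of_le hA <|
      le_iSup_of_le hB <| le_iSup_of_le hμ le_rfl
  refine h1.trans ?_
  have h2 : cohCapacity σ P / ENNReal.ofReal P ≤ cohCapacityPerEnergy σ :=
    le_iSup₂_of_le P hP le_rfl
  rwa [ENNReal.div_le_iff (by simpa using hP) (by finiteness)] at h2

lemma measurable_cohOutput_real (hA : IsBorelFamily A) (hB : IsBorelFamily B) (x : ℂ)
    (y : Bool × Bool) : Measurable fun h => (cohOutput σ A B h x).real {y} := by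
  have hq : Measurable fun p : ℂ × ℂ => quantize (A p.1) (B p.1) (p.1 * x + p.2) := by
    refine Measurable.prodMk (measurable_to_bool ?_) (measurable_to_bool ?_)
    · have : Measurable fun p : ℂ × ℂ => (p.1, (p.1 * x + p.2).re) := by fun_prop
      convert! this hA
      ext; simp
    · have : Measurable fun p : ℂ × ℂ => (p.1, (p.1 * x + p.2).im) := by fun_prop
      convert! this hB
      ext; simp
  have h := measurable_measure_prodMk_left (ν := noiseLaw σ) (hq (measurableSet_singleton y))
  have he : (fun h => (cohOutput σ A B h x).real {y}) = fun h => (noiseLaw σ (Prod.mk h ⁻¹'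
      ((fun p : ℂ × ℂ => quantize (A p.1) (B p.1) (p.1 * x + p.2)) ⁻¹' {y}))).toReal := by
    ext h
    rw [measureReal_def, cohOutput, Measure.map_apply _ (measurableSet_singleton y)]
    · rfl
    · exact (measurable_channel_coh hA hB h).comp measurable_prodMk_left
  rw [he]
  exact h.ennreal_toReal

lemma cohRate_le_capacityPerEnergy (hσ : 0 < σ) (hA : IsBorelFamily A) (hB : IsBorelFamily B)
    {ξ : ℂ} (hξ : ξ ≠ 0) : cohRate σ A B ξ ≤ cohCapacityPerEnergy σ := by
  have hp := isProbabilityMeasure_cohOutput (σ := σ) hA hB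
  have hac := cohOutput_ac hσ hA hB
  set D : ℕ → ℂ → ℝ≥0∞ := fun n h => klDiv (cohOutput σ A B h ξ)
    (mixture (onOffProb n) (cohOutput σ A B h ξ) (cohOutput σ A B h 0)) with hD
  have hDm : ∀ n, Measurable (D n) := by
    intro n
    have h0 := onOffProb_pos n
    have h1 := onOffProb_lt_one n
    have hmix := fun h => isProbabilityMeasure_mixture h0.le h1.le (cohOutput σ A B h ξ)
      (cohOutput σ A B h 0)
    have hr : ∀ h y, (mixture (onOffProb n) (cohOutput σ A B h ξ)
        (cohOutput σ A B h 0)).real {y} = (1 - onOffProb n) * (cohOutput σ A B h 0).real {y} +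
          onOffProb n * (cohOutput σ A B h ξ).real {y} := fun h y =>
      mixture_real h0.le h1.le _ _ _
    simp_rw [hD, fun h => klDiv_fintype
      ((hac h ξ).trans (absolutelyContinuous_mixture h1 (cohOutput σ A B h ξ) _)), hr]
    have m1 := fun y => measurable_cohOutput_real (σ := σ) hA hB ξ y
    have m0 := fun y => measurable_cohOutput_real (σ := σ) hA hB 0 y
    refine Finset.measurable_sum _ fun y _ => Measurable.ennreal_ofReal ?_
    have m2 : Measurable fun h => (1 - onOffProb n) * (cohOutput σ A B h 0).real {y} +
          onOffProb n * (cohOutput σ A B h ξ).real {y} :=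
      ((m0 y).const_mul _).add ((m1 y).const_mul _)
    exact m2.mul (measurable_klFun.comp ((m1 y).div m2))
  have hle : ∀ n, ∫⁻ h, D n h ∂fadingLaw ≤ cohCapacityPerEnergy σ * ‖ξ‖ₑ ^ 2 := by
    intro n
    have h0 := onOffProb_pos n
    have h1 := onOffProb_lt_one n
    have hI := cohInfo_le_capacityPerEnergy (σ := σ) hA hB (P := onOffProb n * ‖ξ‖ ^ 2)
      (by positivity) (isAdmissibleInput_onOff h0.le h1.le ξ)
    have hlow : ENNReal.ofReal (onOffProb n) * ∫⁻ h, D n h ∂fadingLaw ≤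
        cohInfo σ A B (mixture (onOffProb n) (Measure.dirac ξ) (Measure.dirac 0)) := by
      rw [← lintegral_const_mul _ (hDm n)]
      exact lintegral_mono fun h => le_mutualInfo_onOff (noiseLaw σ)
        (measurable_channel_coh hA hB h) h0.le h1 ξ 0 (hac h)
    have h3 := hlow.trans hI
    rw [ENNReal.ofReal_mul h0.le, ofReal_norm_sq, mul_left_comm] at h3
    exact (ENNReal.mul_le_mul_iff_right (by simpa using h0) (by finiteness)).1 h3
  rw [cohRate, ENNReal.div_le_iff (by simpa using hξ) (by finiteness)]
  calc ∫⁻ h, klDiv (cohOutput σ A B h ξ) (cohOutput σ A B h 0) ∂fadingLaw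
      = ∫⁻ h, liminf (fun n => D n h) atTop ∂fadingLaw := by
        refine lintegral_congr fun h => ?_
        have := hp h ξ
        have := hp h 0
        exact (tendsto_klDiv_mixture (hac h ξ) (fun n => (onOffProb_pos n).le) onOffProb_lt_one
          tendsto_onOffProb).liminf_eq.symm
    _ ≤ liminf (fun n => ∫⁻ h, D n h ∂fadingLaw) atTop := lintegral_liminf_le hDm
    _ ≤ liminf (fun _ : ℕ => cohCapacityPerEnergy σ * ‖ξ‖ₑ ^ 2) atTop :=
        liminf_le_liminf (Eventually.of_forall hle)
    _ = _ := liminf_const _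

end CoherentLower

/-! ### The coherent channel: threshold quantizers -/

lemma mul_klFun_div {p q : ℝ} (h : q = 0 → p = 0) :
    q * klFun (p / q) = p * Real.log p - p * Real.log q + q - p := by
  by_cases hq : q = 0
  · simp [hq, h hq]
  by_cases hp : p = 0
  · simp [hp, klFun_apply]
  rw [klFun_apply, Real.log_div hp hq]
  field_simp

/-- The binary relative entropy in terms of the binary entropy. -/
lemma klDiv_bitLaw_eq_binEntropy {S : Set ℝ} (hS : MeasurableSet S) {μ ν : Measure ℝ}
    [IsProbabilityMeasure μ] [IsProbabilityMeasure ν] (h : μ ≪ ν) :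
    klDiv (bitLaw S μ) (bitLaw S ν) = ENNReal.ofReal (μ.real S * -Real.log (ν.real S) +
      μ.real Sᶜ * -Real.log (ν.real Sᶜ) - Real.binEntropy (μ.real S)) := by
  have hz : ∀ s, ν.real s = 0 → μ.real s = 0 := fun s hs => by
    rw [measureReal_eq_zero_iff] at hs ⊢
    exact h hs
  rw [klDiv_bitLaw hS h, mul_klFun_div (hz S), mul_klFun_div (hz Sᶜ), Real.binEntropy,
    Real.log_inv, Real.log_inv, ← probReal_compl_eq_one_sub hS]
  congr 1
  have h1 := probReal_compl_eq_one_sub (μ := μ) hS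
  have h2 := probReal_compl_eq_one_sub (μ := ν) hS
  linear_combination h2 - h1

lemma measureReal_mul_neg_log_nonneg {μ ν : Measure ℝ} [IsProbabilityMeasure ν] (S : Set ℝ) :
    0 ≤ μ.real S * -Real.log (ν.real S) :=
  mul_nonneg measureReal_nonneg
    (neg_nonneg.2 (Real.log_nonpos measureReal_nonneg measureReal_le_one))

/-- A cell of probability at most `exp (-b)` under `ν` and at least `a` under `μ` makes the relative
entropy of the bit at least `a b - log 2`. -/
lemma le_klDiv_bitLaw {S C : Set ℝ} (hS : MeasurableSet S) (hC : C = S ∨ C = Sᶜ)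
    {μ ν : Measure ℝ} [IsProbabilityMeasure μ] [IsProbabilityMeasure ν] (h : μ ≪ ν) {a b : ℝ}
    (hb : 0 ≤ b) (hν : ν.real C ≤ Real.exp (-b)) (hμ : a ≤ μ.real C) :
    ENNReal.ofReal (a * b - Real.log 2) ≤ klDiv (bitLaw S μ) (bitLaw S ν) := by
  rw [klDiv_bitLaw_eq_binEntropy hS h]
  refine ENNReal.ofReal_le_ofReal ?_
  have h1 := measureReal_mul_neg_log_nonneg (μ := μ) (ν := ν) S
  have h2 := measureReal_mul_neg_log_nonneg (μ := μ) (ν := ν) Sᶜ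
  have h3 := Real.binEntropy_le_log_two (p := μ.real S)
  have key : a * b ≤ μ.real C * -Real.log (ν.real C) := by
    by_cases hz : ν.real C = 0
    · have hz' : μ.real C = 0 := by
        rw [measureReal_eq_zero_iff] at hz ⊢
        exact h hz
      rw [hz', zero_mul]
      exact mul_nonpos_of_nonpos_of_nonneg (hz' ▸ hμ) hb
    · have hpos : 0 < ν.real C := lt_of_le_of_ne measureReal_nonneg (Ne.symm hz)
      have hlog : b ≤ -Real.log (ν.real C) := by
        have := (Real.log_le_log hpos hν)
        rw [Real.log_exp] at this
        linarith
      exact mul_le_mul hμ hlog hb measureReal_nonneg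
  rcases hC with rfl | rfl <;> linarith

lemma gaussianReal_upper_tail {a t : ℝ} {v : ℝ≥0} (hv : v ≠ 0) (h : a ≤ t) :
    (gaussianReal a v).real {u | t ≤ u} ≤ Real.exp (-((t - a) ^ 2 / (2 * v))) := by
  have hv' : (0 : ℝ) < v := by positivity
  have := measure_ge_le_exp_mul_mgf (μ := gaussianReal a v) (X := id) t
    (t := (t - a) / v) (div_nonneg (by linarith) hv'.le) (integrable_exp_mul_gaussianReal _)
  rw [mgf_id_gaussianReal, ← Real.exp_add] at this
  refine this.trans (Real.exp_le_exp.2 (le_of_eq ?_))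
  field_simp
  ring

lemma gaussianReal_lower_tail {a t : ℝ} {v : ℝ≥0} (hv : v ≠ 0) (h : t ≤ a) :
    (gaussianReal a v).real {u | u ≤ t} ≤ Real.exp (-((t - a) ^ 2 / (2 * v))) := by
  have hv' : (0 : ℝ) < v := by positivity
  have := measure_le_le_exp_mul_mgf (μ := gaussianReal a v) (X := id) t
    (t := (t - a) / v) (div_nonpos_of_nonpos_of_nonneg (by linarith) hv'.le)
    (integrable_exp_mul_gaussianReal _)
  rw [mgf_id_gaussianReal, ← Real.exp_add] at this
  refine this.trans (Real.exp_le_exp.2 (le_of_eq ?_))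
  field_simp
  ring

/-- The distance of the threshold from the origin when the noiseless output is `± b`: it tends to
infinity like `b`, and so does its distance `√b` from the noiseless output, but more slowly. -/
noncomputable def thresholdDist (b : ℝ) : ℝ := max (b - √b) 0

/-- The threshold used for a noiseless output component `a`: on the same side of the origin as `a`,
and slightly closer to it. -/
noncomputable def threshold (a : ℝ) : ℝ :=
  if 0 ≤ a then thresholdDist |a| else -thresholdDist |a|

/-- A lower bound on the relative entropy that one threshold bit conveys; `b` is the absolute value
of the noiseless output and `v` is the variance of the noise. -/
noncomputable def thresholdGain (v b : ℝ) : ℝ :=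
  (1 - Real.exp (-((b - thresholdDist b) ^ 2 / (2 * v)))) * (thresholdDist b ^ 2 / (2 * v)) -
    Real.log 2

lemma measurable_thresholdDist : Measurable thresholdDist := by
  unfold thresholdDist
  fun_prop

lemma measurable_threshold : Measurable threshold := by
  have h := measurable_thresholdDist.comp measurable_norm (α := ℝ)
  exact Measurable.ite measurableSet_Ici h h.neg

lemma measurable_thresholdGain (v : ℝ) : Measurable (thresholdGain v) := by
  have := measurable_thresholdDist
  unfold thresholdGain
  fun_prop

lemma thresholdGain_le_klDiv {v : ℝ≥0} (hv : v ≠ 0) (a : ℝ) :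
    ENNReal.ofReal (thresholdGain v |a|) ≤ klDiv (bitLaw {u | threshold a ≤ u} (gaussianReal a v))
      (bitLaw {u | threshold a ≤ u} (gaussianReal 0 v)) := by
  have hS : MeasurableSet {u | threshold a ≤ u} := measurableSet_Ici
  have hv' : (0 : ℝ) < v := by positivity
  have hd0 : 0 ≤ thresholdDist |a| := le_max_right _ _
  have hd1 : thresholdDist |a| ≤ |a| :=
    max_le (by linarith [Real.sqrt_nonneg |a|]) (abs_nonneg a)
  by_cases ha : 0 ≤ a
  · have hT : threshold a = thresholdDist |a| := if_pos ha
    rw [abs_of_nonneg ha] at hT hd0 hd1 ⊢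
    refine le_klDiv_bitLaw hS (Or.inl rfl) (gaussianReal_ac a hv hv) (by positivity) ?_ ?_
    · have := gaussianReal_upper_tail hv hd0
      simpa only [sub_zero, hT] using this
    · have h1 := gaussianReal_lower_tail hv hd1
      have h2 := probReal_compl_eq_one_sub (μ := gaussianReal a v) hS
      have h3 : (gaussianReal a v).real {u | threshold a ≤ u}ᶜ ≤
          (gaussianReal a v).real {u | u ≤ thresholdDist a} :=
        measureReal_mono fun u hu => by
          simp only [mem_compl_iff, mem_ofPred_eq, not_le, hT] at hu
          exact hu.le
      rw [show (thresholdDist a - a) ^ 2 = (a - thresholdDist a) ^ 2 by ring] at h1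
      linarith
  · have hT : threshold a = -thresholdDist |a| := if_neg ha
    rw [abs_of_neg (not_le.1 ha)] at hT hd0 hd1 ⊢
    refine le_klDiv_bitLaw hS (Or.inr rfl) (gaussianReal_ac a hv hv) (by positivity) ?_ ?_
    · have h1 := gaussianReal_lower_tail hv (a := 0) (t := -thresholdDist (-a)) (by linarith)
      have h3 : (gaussianReal 0 v).real {u | threshold a ≤ u}ᶜ ≤
          (gaussianReal 0 v).real {u | u ≤ -thresholdDist (-a)} :=
        measureReal_mono fun u hu => by
          simp only [mem_compl_iff, mem_ofPred_eq, not_le, hT] at hu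
          exact hu.le
      rw [sub_zero, neg_sq] at h1
      exact h3.trans h1
    · have h1 := gaussianReal_upper_tail hv (a := a) (t := -thresholdDist (-a)) (by linarith)
      have h2 := probReal_compl_eq_one_sub (μ := gaussianReal a v) hS
      rw [← hT, show (threshold a - a) ^ 2 = (-a - thresholdDist (-a)) ^ 2 by rw [hT]; ring] at h1
      linarith

lemma tendsto_thresholdGain_div {v : ℝ} (hv : 0 < v) :
    Tendsto (fun b => thresholdGain v b / b ^ 2) atTop (𝓝 (1 / (2 * v))) := by
  have h1 : Tendsto (fun b : ℝ => Real.exp (-(b / (2 * v)))) atTop (𝓝 0) :=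
    Real.tendsto_exp_neg_atTop_nhds_zero.comp (tendsto_id.atTop_div_const (by positivity))
  have h2 : Tendsto (fun b : ℝ => 1 / √b) atTop (𝓝 0) :=
    tendsto_const_nhds.div_atTop Real.tendsto_sqrt_atTop
  have h3 : Tendsto (fun b : ℝ => Real.log 2 / b ^ 2) atTop (𝓝 0) :=
    tendsto_const_nhds.div_atTop (tendsto_pow_atTop two_ne_zero)
  have h := (((tendsto_const_nhds (x := (1 : ℝ))).sub h1).mul
    ((((tendsto_const_nhds (x := (1 : ℝ))).sub h2).pow 2).div_const (2 * v))).sub h3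
  simp only [sub_zero, one_pow, one_mul] at h
  refine h.congr' ?_
  filter_upwards [eventually_ge_atTop 1] with b hb
  have hb0 : 0 ≤ b := by linarith
  have hs : 0 < √b := Real.sqrt_pos.2 (by linarith)
  have hsq : √b ^ 2 = b := Real.sq_sqrt hb0
  have hd : thresholdDist b = b - √b := by
    refine max_eq_left ?_
    have : √b * 1 ≤ √b * √b := by
      gcongr
      exact Real.one_le_sqrt.2 hb
    nlinarith
  rw [thresholdGain, hd, show (b - (b - √b)) ^ 2 = b by rw [sub_sub_cancel, hsq]]
  have : (1 - 1 / √b) ^ 2 = (b - √b) ^ 2 / b ^ 2 := by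
    rw [← div_pow]
    congr 1
    field_simp
    linear_combination hsq
  rw [this]
  field_simp

lemma tendsto_thresholdGain_scaled {v : ℝ} (hv : 0 < v) (g : ℝ) :
    Tendsto (fun n : ℕ => thresholdGain v |((n : ℝ) + 1) * g| / ((n : ℝ) + 1) ^ 2) atTop
      (𝓝 (g ^ 2 / (2 * v))) := by
  have hn : Tendsto (fun n : ℕ => (n : ℝ) + 1) atTop atTop :=
    tendsto_atTop_add_const_right _ _ tendsto_natCast_atTop_atTop
  by_cases hg : g = 0
  · have h0 : thresholdGain v 0 = -Real.log 2 := by simp [thresholdGain, thresholdDist]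
    simp only [hg, mul_zero, abs_zero, h0, ne_eq, OfNat.ofNat_ne_zero, not_false_eq_true, zero_pow,
      zero_div]
    exact tendsto_const_nhds.div_atTop ((tendsto_pow_atTop two_ne_zero).comp hn)
  · have hb : Tendsto (fun n : ℕ => |((n : ℝ) + 1) * g|) atTop atTop := by
      simp_rw [abs_mul]
      exact (tendsto_abs_atTop_atTop.comp hn).atTop_mul_const (abs_pos.2 hg)
    have h := ((tendsto_thresholdGain_div hv).comp hb).mul_const (g ^ 2)
    rw [show 1 / (2 * v) * g ^ 2 = g ^ 2 / (2 * v) by ring] at h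
    refine h.congr fun n => ?_
    have : (n : ℝ) + 1 ≠ 0 := by positivity
    simp only [Function.comp, sq_abs]
    field_simp

lemma isBorelFamily_threshold {T : ℝ → ℝ} (hT : Measurable T) {f : ℂ → ℝ} (hf : Measurable f) :
    IsBorelFamily (fun h => {u | T (f h) ≤ u}) :=
  measurableSet_le (hT.comp (hf.comp measurable_fst)) measurable_snd

lemma le_iSup_cohRate_threshold {σ : ℝ} (hσ : 0 < σ) :
    ENNReal.ofReal (1 / σ ^ 2) ≤ ⨆ (ξ : ℂ) (_ : ξ ≠ 0),
      cohRate σ (fun h => {u | threshold (h * ξ).re ≤ u})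
        (fun h => {u | threshold (h * ξ).im ≤ u}) ξ := by
  set R := ⨆ (ξ : ℂ) (_ : ξ ≠ 0), cohRate σ (fun h => {u | threshold (h * ξ).re ≤ u})
        (fun h => {u | threshold (h * ξ).im ≤ u}) ξ with hR
  have hs := noiseVar_ne_zero hσ
  have hs' : (0 : ℝ) < noiseVar σ := by positivity
  set G : ℕ → ℂ → ℝ≥0∞ := fun n h =>
    ENNReal.ofReal (thresholdGain (noiseVar σ) |((n : ℝ) + 1) * h.re| / ((n : ℝ) + 1) ^ 2) +
    ENNReal.ofReal (thresholdGain (noiseVar σ) |((n : ℝ) + 1) * h.im| / ((n : ℝ) + 1) ^ 2) with hG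
  have hGm : ∀ n, Measurable (G n) := by
    intro n
    have := measurable_thresholdGain (noiseVar σ)
    fun_prop
  have hle : ∀ n, ∫⁻ h, G n h ∂fadingLaw ≤ R := by
    intro n
    have hn : (0 : ℝ) < (n : ℝ) + 1 := by positivity
    set ξ : ℂ := (((n : ℝ) + 1 : ℝ) : ℂ) with hξd
    have hξ : ξ ≠ 0 := by
      rw [hξd]
      exact_mod_cast hn.ne'
    refine le_trans ?_ (le_iSup₂_of_le ξ hξ le_rfl)
    have hre : ∀ h : ℂ, (h * ξ).re = ((n : ℝ) + 1) * h.re := fun h => by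
      rw [hξd, Complex.re_mul_ofReal, mul_comm]
    have him : ∀ h : ℂ, (h * ξ).im = ((n : ℝ) + 1) * h.im := fun h => by
      rw [hξd, Complex.im_mul_ofReal, mul_comm]
    have hnorm : ‖ξ‖ₑ ^ 2 = ENNReal.ofReal (((n : ℝ) + 1) ^ 2) := by
      rw [← ofReal_norm_sq, hξd, Complex.norm_real, Real.norm_eq_abs, sq_abs]
    have hA := isBorelFamily_threshold measurable_threshold (f := fun h : ℂ => (h * ξ).re)
      (by fun_prop)
    have hB := isBorelFamily_threshold measurable_threshold (f := fun h : ℂ => (h * ξ).im)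
      (by fun_prop)
    rw [cohRate, ENNReal.le_div_iff_mul_le (by simp [hξ]) (by simp), hnorm,
      ← lintegral_mul_const _ (hGm n)]
    refine lintegral_mono fun h => ?_
    have p1 := isProbabilityMeasure_bitLaw (hA.measurableSet h)
    have p2 := isProbabilityMeasure_bitLaw (hB.measurableSet h)
    rw [cohOutput_eq_prod hA hB, cohOutput_eq_prod hA hB, klDiv_prod, mul_zero, Complex.zero_re,
      Complex.zero_im, hG, add_mul, ← ENNReal.ofReal_mul' (by positivity),
      ← ENNReal.ofReal_mul' (by positivity), div_mul_cancel₀ _ (by positivity),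
      div_mul_cancel₀ _ (by positivity), ← hre, ← him]
    exact add_le_add (thresholdGain_le_klDiv hs _) (thresholdGain_le_klDiv hs _)
  calc ENNReal.ofReal (1 / σ ^ 2)
      = ∫⁻ h, ENNReal.ofReal (1 / σ ^ 2) * ‖h‖ₑ ^ 2 ∂fadingLaw := by
        rw [lintegral_const_mul _ (by fun_prop), lintegral_enorm_sq_fading, mul_one]
    _ = ∫⁻ h, liminf (fun n => G n h) atTop ∂fadingLaw := by
        refine lintegral_congr fun h => ?_
        have h1 := (ENNReal.continuous_ofReal.tendsto _).comp
          (tendsto_thresholdGain_scaled hs' h.re)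
        have h2 := (ENNReal.continuous_ofReal.tendsto _).comp
          (tendsto_thresholdGain_scaled hs' h.im)
        have h3 : Tendsto (fun n => G n h) atTop _ := h1.add h2
        rw [h3.liminf_eq, ← ENNReal.ofReal_add (by positivity) (by positivity), ← ofReal_norm_sq,
          ← ENNReal.ofReal_mul (by positivity), coe_noiseVar, Complex.sq_norm,
          Complex.normSq_apply]
        congr 1
        field_simp
    _ ≤ liminf (fun n => ∫⁻ h, G n h ∂fadingLaw) atTop := lintegral_liminf_le hGm
    _ ≤ liminf (fun _ : ℕ => R) atTop := liminf_le_liminf (Eventually.of_forall hle)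
    _ = R := liminf_const _

/-! ### The loss of one-bit quantization of centred Gaussian laws -/

lemma gaussianReal_scaled_sq {v : ℝ≥0} (hv : v ≠ 0) {E : Set ℝ} (hE : MeasurableSet E) :
    (gaussianReal 0 v).real {u | u ^ 2 / v ∈ E} = (gaussianReal 0 1).real {u | u ^ 2 ∈ E} := by
  have hv' : (0 : ℝ) < v := by positivity
  have h := gaussianReal_map_const_mul (μ := 0) (v := 1) (√(v : ℝ))
  have hmk : (NNReal.mk (√(v : ℝ) ^ 2) (sq_nonneg _) : ℝ≥0) = v :=
    NNReal.eq (Real.sq_sqrt hv'.le)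
  rw [mul_zero, mul_one, hmk] at h
  have hm : Measurable fun u : ℝ => u ^ 2 / v := by fun_prop
  rw [← h, show {u : ℝ | u ^ 2 / v ∈ E} = (fun u : ℝ => u ^ 2 / v) ⁻¹' E from rfl,
    map_measureReal_apply (by fun_prop) (hm hE)]
  congr 1
  ext u
  simp only [mem_preimage, mem_ofPred_eq, mul_pow, Real.sq_sqrt hv'.le]
  rw [mul_div_cancel_left₀ _ hv'.ne']

lemma gaussianReal_sq_mem_Icc_pos :
    0 < (gaussianReal 0 1).real {u | u ^ 2 ∈ Icc (1 / 4 : ℝ) (1 / 2)} := by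
  have h1 : 0 < (gaussianReal 0 1).real (Ioo (1 / 2 : ℝ) (7 / 10)) := by
    refine lt_of_le_of_ne measureReal_nonneg fun h => ?_
    rw [eq_comm, measureReal_eq_zero_iff] at h
    have h0 := gaussianReal_absolutelyContinuous' 0 one_ne_zero h
    rw [Real.volume_Ioo, ENNReal.ofReal_eq_zero] at h0
    norm_num at h0
  refine h1.trans_le (measureReal_mono fun u hu => ?_)
  simp only [mem_ofPred_eq, mem_Icc]
  constructor <;> nlinarith [hu.1, hu.2]

lemma gaussianLogRatio_le {v w : ℝ≥0} (hw : w ≠ 0) (hwv : w ≤ v) (u : ℝ) :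
    gaussianLogRatio 0 v w u ≤ (v / w - 1) / (2 * v) * u ^ 2 := by
  have hw' : (0 : ℝ) < w := by positivity
  have hwv' : (w : ℝ) ≤ v := by exact_mod_cast hwv
  have hv' : (0 : ℝ) < v := hw'.trans_le hwv'
  have hlog : Real.log (w / v) ≤ 0 :=
    Real.log_nonpos (by positivity) ((div_le_one hv').2 hwv')
  have he : (v / w - 1) / (2 * v) * u ^ 2 = u ^ 2 / (2 * w) - u ^ 2 / (2 * v) := by
    field_simp
  rw [gaussianLogRatio, he, sub_zero]
  linarith

/-- The contribution of the cell `S` of a one-bit quantizer to the relative entropy between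
centred Gaussian laws of variances `v` and `w`. -/
noncomputable def cellDiv (v w : ℝ≥0) (S : Set ℝ) : ℝ :=
  (gaussianReal 0 w).real S * klFun ((gaussianReal 0 v).real S / (gaussianReal 0 w).real S)

lemma gaussianReal_real_eq_zero {v w : ℝ≥0} (hv : v ≠ 0) (hw : w ≠ 0) {S : Set ℝ}
    (h : (gaussianReal 0 w).real S = 0) : (gaussianReal 0 v).real S = 0 := by
  rw [measureReal_eq_zero_iff] at h ⊢
  exact gaussianReal_ac 0 hv hw h

lemma cellDiv_le_of_half_le {v w : ℝ≥0} (hv : v ≠ 0) (hw : w ≠ 0) {S : Set ℝ}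
    (h : 1 / 2 ≤ (gaussianReal 0 w).real S) : cellDiv v w S ≤ 2 := by
  rw [cellDiv, mul_klFun_div (gaussianReal_real_eq_zero hv hw)]
  have hp0 : 0 ≤ (gaussianReal 0 v).real S := measureReal_nonneg
  have hp1 : (gaussianReal 0 v).real S ≤ 1 := measureReal_le_one
  have hq1 : (gaussianReal 0 w).real S ≤ 1 := measureReal_le_one
  have h1 := mul_nonpos_of_nonneg_of_nonpos hp0 (Real.log_nonpos hp0 hp1)
  have h2 : -Real.log ((gaussianReal 0 w).real S) ≤ Real.log 2 := by
    have := Real.log_le_log (by norm_num) h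
    rw [Real.log_div one_ne_zero two_ne_zero, Real.log_one] at this
    linarith
  have h3 := mul_le_mul_of_nonneg_left h2 hp0
  have h4 := Real.log_two_lt_d9
  have h5 : (gaussianReal 0 v).real S * Real.log 2 ≤ 1 * Real.log 2 := by
    gcongr
  linarith

/-- The contribution of a cell is controlled by the second moment on that cell. -/
lemma cellDiv_le_second_moment {v w : ℝ≥0} (hw : w ≠ 0) (hwv : w ≤ v) {S : Set ℝ}
    (hS : MeasurableSet S) :
    cellDiv v w S ≤ (v / w - 1) / (2 * v) * ∫ u in S, u ^ 2 ∂gaussianReal 0 v + 1 := by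
  have hv : v ≠ 0 := (lt_of_lt_of_le (pos_iff_ne_zero.2 hw) hwv).ne'
  have h := gaussian_cell_le 0 hv hw hS
  have h1 : ∫ u in S, gaussianLogRatio 0 v w u ∂gaussianReal 0 v ≤
      ∫ u in S, (v / w - 1) / (2 * v) * u ^ 2 ∂gaussianReal 0 v :=
    integral_mono (integrable_gaussianLogRatio 0 v w).integrableOn
      ((integrable_sq_gaussianReal 0 v).const_mul _).integrableOn
      (gaussianLogRatio_le hw hwv)
  rw [integral_const_mul] at h1
  have hp0 : 0 ≤ (gaussianReal 0 v).real S := measureReal_nonneg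
  have hq1 : (gaussianReal 0 w).real S ≤ 1 := measureReal_le_one
  rw [cellDiv]
  linarith

/-- The region where the output energy is between a quarter and a half of its mean `v`. -/
def lowEnergy (v : ℝ≥0) : Set ℝ := {u | u ^ 2 / v ∈ Icc (1 / 4 : ℝ) (1 / 2)}

lemma measurableSet_lowEnergy (v : ℝ≥0) : MeasurableSet (lowEnergy v) := by
  have hm : Measurable fun u : ℝ => u ^ 2 / v := by fun_prop
  exact hm measurableSet_Icc

/-- A cell that contains a part of the low-energy region is so likely in the absence of a signal
that, up to a constant, it contributes at most `(v / w - 1) / 4`, half of what an unquantized output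
can give. -/
lemma cellDiv_le_of_lowEnergy {v w : ℝ≥0} (hw : w ≠ 0) (hwv : w ≤ v) {S : Set ℝ}
    (hS : MeasurableSet S) {η : ℝ} (hη : 0 < η)
    (h : η ≤ (gaussianReal 0 v).real (S ∩ lowEnergy v)) :
    cellDiv v w S ≤ (v / w - 1) / 4 - Real.log η + 1 := by
  have hw' : (0 : ℝ) < w := by positivity
  have hwv' : (w : ℝ) ≤ v := by exact_mod_cast hwv
  have hv' : (0 : ℝ) < v := hw'.trans_le hwv'
  have hv : v ≠ 0 := by exact_mod_cast hv'.ne'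
  have hx : (0 : ℝ) ≤ v / w - 1 := by
    rw [sub_nonneg, le_div_iff₀ hw']
    linarith
  have hSW := hS.inter (measurableSet_lowEnergy v)
  set p' := (gaussianReal 0 v).real (S ∩ lowEnergy v) with hp'
  set q' := (gaussianReal 0 w).real (S ∩ lowEnergy v) with hq'
  have hp'0 : 0 < p' := hη.trans_le h
  have hz := gaussianReal_real_eq_zero hv hw (S := S ∩ lowEnergy v)
  have hq'0 : 0 < q' :=
    lt_of_le_of_ne measureReal_nonneg fun h0 => hp'0.ne' (hz h0.symm)
  have hcell := gaussian_cell_le 0 hv hw hSW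
  rw [mul_klFun_div hz, ← hp', ← hq'] at hcell
  have hint : ∫ u in S ∩ lowEnergy v, gaussianLogRatio 0 v w u ∂gaussianReal 0 v ≤
      p' * ((v / w - 1) / 4) := by
    have h1 : ∫ u in S ∩ lowEnergy v, gaussianLogRatio 0 v w u ∂gaussianReal 0 v ≤
        ∫ u in S ∩ lowEnergy v, ((v / w - 1) / 4 : ℝ) ∂gaussianReal 0 v := by
      refine setIntegral_mono_on (integrable_gaussianLogRatio 0 v w).integrableOn
        (integrable_const _).integrableOn hSW fun u hu => ?_
      refine (gaussianLogRatio_le hw hwv u).trans ?_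
      have h2 : u ^ 2 / v ≤ 1 / 2 := hu.2.2
      calc (v / w - 1 : ℝ) / (2 * v) * u ^ 2 = (v / w - 1 : ℝ) / 2 * (u ^ 2 / v) := by
            field_simp
        _ ≤ (v / w - 1 : ℝ) / 2 * (1 / 2) := by gcongr
        _ = _ := by ring
    rwa [setIntegral_const, smul_eq_mul] at h1
  have hlogq' : -Real.log q' ≤ (v / w - 1) / 4 - Real.log p' := by
    have : p' * -Real.log q' ≤ p' * ((v / w - 1) / 4 - Real.log p') := by linarith
    exact le_of_mul_le_mul_left this hp'0
  have hlogp' : Real.log η ≤ Real.log p' := Real.log_le_log hη h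
  have hlogq : Real.log q' ≤ Real.log ((gaussianReal 0 w).real S) :=
    Real.log_le_log hq'0 (measureReal_mono inter_subset_left)
  rw [cellDiv, mul_klFun_div (gaussianReal_real_eq_zero hv hw)]
  have hp0 : 0 ≤ (gaussianReal 0 v).real S := measureReal_nonneg
  have hp1 : (gaussianReal 0 v).real S ≤ 1 := measureReal_le_one
  have hq1 : (gaussianReal 0 w).real S ≤ 1 := measureReal_le_one
  have h1 := mul_nonpos_of_nonneg_of_nonpos hp0 (Real.log_nonpos hp0 hp1)
  have h2 : (gaussianReal 0 v).real S * -Real.log ((gaussianReal 0 w).real S) ≤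
      1 * ((v / w - 1) / 4 - Real.log η) := by
    refine mul_le_mul hp1 (by linarith) ?_ zero_le_one
    exact neg_nonneg.2 (Real.log_nonpos measureReal_nonneg hq1)
  linarith

/-- A cell that leaves out a part of the low-energy region misses a fixed fraction of the second
moment. -/
lemma cellDiv_le_of_lowEnergy_compl {v w : ℝ≥0} (hw : w ≠ 0) (hwv : w ≤ v) {S : Set ℝ}
    (hS : MeasurableSet S) {η : ℝ} (h : η ≤ (gaussianReal 0 v).real (Sᶜ ∩ lowEnergy v)) :
    cellDiv v w S ≤ (1 - η / 4) * ((v / w - 1) / 2) + 1 := by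
  have hw' : (0 : ℝ) < w := by positivity
  have hwv' : (w : ℝ) ≤ v := by exact_mod_cast hwv
  have hv' : (0 : ℝ) < v := hw'.trans_le hwv'
  have hx : (0 : ℝ) ≤ v / w - 1 := by
    rw [sub_nonneg, le_div_iff₀ hw']
    linarith
  have hi := integrable_sq_gaussianReal 0 v
  have hsum := integral_add_compl hS hi
  rw [integral_sq_gaussianReal] at hsum
  have hlow : v / 4 * η ≤ ∫ u in Sᶜ, u ^ 2 ∂gaussianReal 0 v := by
    calc v / 4 * η ≤ v / 4 * (gaussianReal 0 v).real (Sᶜ ∩ lowEnergy v) := by gcongr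
      _ = ∫ u in Sᶜ ∩ lowEnergy v, (v / 4 : ℝ) ∂gaussianReal 0 v := by
        rw [setIntegral_const, smul_eq_mul, mul_comm]
      _ ≤ ∫ u in Sᶜ ∩ lowEnergy v, u ^ 2 ∂gaussianReal 0 v := by
        refine setIntegral_mono_on (integrable_const _).integrableOn hi.integrableOn
          (hS.compl.inter (measurableSet_lowEnergy v)) fun u hu => ?_
        have h2 : 1 / 4 ≤ u ^ 2 / v := hu.2.1
        rw [le_div_iff₀ hv'] at h2
        linarith
      _ ≤ ∫ u in Sᶜ, u ^ 2 ∂gaussianReal 0 v :=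
        setIntegral_mono_set hi.integrableOn (ae_of_all _ fun u => sq_nonneg u)
          inter_subset_left.eventuallyLE
  have hup : ∫ u in S, u ^ 2 ∂gaussianReal 0 v ≤ v * (1 - η / 4) := by
    simp only [ne_eq, OfNat.ofNat_ne_zero, not_false_eq_true, zero_pow, add_zero] at hsum
    linarith
  refine (cellDiv_le_second_moment hw hwv hS).trans ?_
  have : (v / w - 1) / (2 * v) * ∫ u in S, u ^ 2 ∂gaussianReal 0 v ≤
      (v / w - 1) / (2 * v) * (v * (1 - η / 4)) := by gcongr
  have he : (v / w - 1 : ℝ) / (2 * v) * (v * (1 - η / 4)) =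
      (1 - η / 4) * ((v / w - 1) / 2) := by
    field_simp
  linarith

/-- One-bit quantization of a strong signal loses a fixed fraction of the relative entropy. Only the
cell that is unlikely without a signal matters, and it is costly for it both to contain a fixed part
of the low-energy region and to leave out such a part. -/
lemma cellDiv_add_compl_le {v w : ℝ≥0} (hw : w ≠ 0) (hwv : w ≤ v) {S : Set ℝ}
    (hS : MeasurableSet S) {η : ℝ} (hη : 0 < η) (hη1 : η ≤ 1)
    (h2η : 2 * η ≤ (gaussianReal 0 v).real (lowEnergy v)) :
    cellDiv v w S + cellDiv v w Sᶜ ≤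
      (1 - η / 4) * ((v / w - 1) / 2) + (3 - Real.log η) := by
  have hw' : (0 : ℝ) < w := by positivity
  have hwv' : (w : ℝ) ≤ v := by exact_mod_cast hwv
  have hv' : (0 : ℝ) < v := hw'.trans_le hwv'
  have hv : v ≠ 0 := by exact_mod_cast hv'.ne'
  have hx : (0 : ℝ) ≤ v / w - 1 := by
    rw [sub_nonneg, le_div_iff₀ hw']
    linarith
  have hlog := Real.log_nonpos hη.le hη1
  have key : ∀ C : Set ℝ, MeasurableSet C → 1 / 2 ≤ (gaussianReal 0 w).real C →
      cellDiv v w C + cellDiv v w Cᶜ ≤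
        (1 - η / 4) * ((v / w - 1) / 2) + (3 - Real.log η) := by
    intro C hC hhalf
    have h1 := cellDiv_le_of_half_le hv hw hhalf
    have hsplit := measureReal_inter_add_sdiff (μ := gaussianReal 0 v) (s := lowEnergy v) hC
    rw [sdiff_eq, inter_comm, inter_comm (lowEnergy v)] at hsplit
    by_cases hc : η ≤ (gaussianReal 0 v).real (C ∩ lowEnergy v)
    · have h2 := cellDiv_le_of_lowEnergy_compl hw hwv hC.compl (η := η) (by rwa [compl_compl])
      linarith
    · have h2 := cellDiv_le_of_lowEnergy hw hwv hC.compl hη (by linarith)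
      have h3 : (1 / 2 : ℝ) * ((v / w - 1) / 2) ≤ (1 - η / 4) * ((v / w - 1) / 2) := by
        gcongr
        linarith
      linarith
  by_cases hhalf : 1 / 2 ≤ (gaussianReal 0 w).real S
  · exact key S hS hhalf
  · have h := key Sᶜ hS.compl (by
      rw [probReal_compl_eq_one_sub hS]
      linarith)
    rw [compl_compl] at h
    linarith

lemma klDiv_gaussianReal_centred_le {v w : ℝ≥0} (hw : w ≠ 0) (hwv : w ≤ v) :
    klDiv (gaussianReal 0 v) (gaussianReal 0 w) ≤
      ENNReal.ofReal ((v / w - 1) * (1 - w / v) / 2) := by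
  have hw' : (0 : ℝ) < w := by positivity
  have hwv' : (w : ℝ) ≤ v := by exact_mod_cast hwv
  have hv' : (0 : ℝ) < v := hw'.trans_le hwv'
  have hv : v ≠ 0 := by exact_mod_cast hv'.ne'
  rw [klDiv_gaussianReal 0 hv hw]
  refine ENNReal.ofReal_le_ofReal ?_
  have h1 := Real.log_le_sub_one_of_pos (div_pos hw' hv')
  have h2 : (v / w - 1 : ℝ) * (1 - w / v) / 2 = (w / v - 1) / 2 - 1 / 2 + (v + 0 ^ 2) / (2 * w) := by
    field_simp
    ring
  rw [h2]
  linarith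

/-- One-bit quantization loses a fixed fraction of the bound `(v / w - 1) / 2` on the relative
entropy between centred Gaussian laws, uniformly in the variances and the quantizer. -/
lemma exists_klDiv_bitLaw_le : ∃ c : ℝ, 0 ≤ c ∧ c < 1 ∧ ∀ v w : ℝ≥0, w ≠ 0 → w ≤ v →
    ∀ S : Set ℝ, MeasurableSet S → klDiv (bitLaw S (gaussianReal 0 v))
      (bitLaw S (gaussianReal 0 w)) ≤ ENNReal.ofReal (c * ((v / w - 1) / 2)) := by
  set η := (gaussianReal 0 1).real {u | u ^ 2 ∈ Icc (1 / 4 : ℝ) (1 / 2)} / 2 with hηd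
  have hη : 0 < η := half_pos gaussianReal_sq_mem_Icc_pos
  have hη1 : η ≤ 1 := by
    have : (gaussianReal 0 1).real {u | u ^ 2 ∈ Icc (1 / 4 : ℝ) (1 / 2)} ≤ 1 := measureReal_le_one
    linarith
  have hlog := Real.log_nonpos hη.le hη1
  -- beyond `X`, the constant in the bound for strong signals is at most half of the saving
  set X := 16 * (3 - Real.log η) / η with hX
  have hX0 : 0 ≤ X := by
    refine div_nonneg ?_ hη.le
    linarith
  refine ⟨max (1 - η / 8) (X / (1 + X)), le_max_of_le_left (by linarith),
    max_lt (by linarith) ((div_lt_one (by linarith)).2 (by linarith)), ?_⟩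
  intro v w hw hwv S hS
  have hw' : (0 : ℝ) < w := by positivity
  have hwv' : (w : ℝ) ≤ v := by exact_mod_cast hwv
  have hv' : (0 : ℝ) < v := hw'.trans_le hwv'
  have hv : v ≠ 0 := by exact_mod_cast hv'.ne'
  set x : ℝ := v / w - 1 with hxd
  have hx : 0 ≤ x := by
    rw [hxd, sub_nonneg, le_div_iff₀ hw']
    linarith
  by_cases hxX : X ≤ x
  · rw [klDiv_bitLaw hS (gaussianReal_ac 0 hv hw)]
    refine ENNReal.ofReal_le_ofReal ?_
    have h2η : 2 * η ≤ (gaussianReal 0 v).real (lowEnergy v) := by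
      rw [lowEnergy, gaussianReal_scaled_sq hv measurableSet_Icc, hηd]
      linarith
    have h := cellDiv_add_compl_le hw hwv hS hη hη1 h2η
    have hC : 3 - Real.log η ≤ η / 8 * (x / 2) := by
      rw [hX, div_le_iff₀ hη] at hxX
      linarith
    have hm : (1 - η / 8) * (x / 2) ≤ max (1 - η / 8) (X / (1 + X)) * (x / 2) := by
      gcongr
      exact le_max_left _ _
    refine h.trans (le_trans ?_ hm)
    rw [← hxd]
    linarith
  · refine (klDiv_map_le _ _ (measurable_decide_mem hS)).trans
      ((klDiv_gaussianReal_centred_le hw hwv).trans (ENNReal.ofReal_le_ofReal ?_))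
    have h1 : (1 : ℝ) - w / v = x / (1 + x) := by
      rw [show 1 + x = v / w by rw [hxd]; ring, hxd]
      field_simp
    have h2 : x / (1 + x) ≤ X / (1 + X) := by
      rw [div_le_div_iff₀ (by linarith) (by linarith)]
      nlinarith
    rw [← hxd, h1]
    calc x * (x / (1 + x)) / 2 = x / (1 + x) * (x / 2) := by ring
      _ ≤ max (1 - η / 8) (X / (1 + X)) * (x / 2) := by
        gcongr
        exact h2.trans (le_max_right _ _)

/-! ### The noncoherent channel -/

/-- The variance of each of the two components of the unquantized output, given the input `ξ`. -/
noncomputable def outputVar (σ : ℝ) (ξ : ℂ) : ℝ≥0 := Real.toNNReal (‖ξ‖ ^ 2 + σ ^ 2) / 2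

lemma coe_outputVar (σ : ℝ) (ξ : ℂ) : (outputVar σ ξ : ℝ) = (‖ξ‖ ^ 2 + σ ^ 2) / 2 := by
  simp only [outputVar, NNReal.coe_div, NNReal.coe_ofNat]
  rw [Real.coe_toNNReal _ (by positivity)]

lemma outputVar_zero (σ : ℝ) : outputVar σ 0 = noiseVar σ := by
  apply NNReal.eq
  rw [coe_outputVar, coe_noiseVar]
  simp

lemma noiseVar_le_outputVar (σ : ℝ) (ξ : ℂ) : noiseVar σ ≤ outputVar σ ξ := by
  rw [← NNReal.coe_le_coe, coe_outputVar, coe_noiseVar]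
  have : 0 ≤ ‖ξ‖ ^ 2 := by positivity
  linarith

lemma outputVar_ne_zero {σ : ℝ} (hσ : 0 < σ) (ξ : ℂ) : outputVar σ ξ ≠ 0 :=
  (lt_of_lt_of_le (pos_iff_ne_zero.2 (noiseVar_ne_zero hσ)) (noiseVar_le_outputVar σ ξ)).ne'

lemma outputVar_div (σ : ℝ) (hσ : 0 < σ) (ξ : ℂ) :
    (outputVar σ ξ / noiseVar σ : ℝ) = ‖ξ‖ ^ 2 / σ ^ 2 + 1 := by
  rw [coe_outputVar, coe_noiseVar]
  field_simp

section Noncoherent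

variable {σ : ℝ} {A B : Set ℝ}

lemma noncohOutput_eq_prod (hA : MeasurableSet A) (hB : MeasurableSet B) (x : ℂ) :
    noncohOutput σ A B x = (bitLaw A (gaussianReal 0 (outputVar σ x))).prod
      (bitLaw B (gaussianReal 0 (outputVar σ x))) := by
  have h := map_mul_add_circGaussian 1 (Real.toNNReal (σ ^ 2)) (Real.toNNReal (‖x‖ ^ 2 + σ ^ 2)) x
    (by rw [Real.coe_toNNReal _ (by positivity), Real.coe_toNNReal _ (by positivity)]; simp)
  have hc := map_quantize_complexProd hA hB (gaussianReal 0 (outputVar σ x))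
    (gaussianReal 0 (outputVar σ x))
  have he : complexProd (gaussianReal 0 (outputVar σ x)) (gaussianReal 0 (outputVar σ x)) =
      circGaussian (Real.toNNReal (‖x‖ ^ 2 + σ ^ 2)) := rfl
  rw [← hc, he, ← h, Measure.map_map (measurable_quantize hA hB) (by fun_prop)]
  rfl

lemma isProbabilityMeasure_noncohOutput (hA : MeasurableSet A) (hB : MeasurableSet B) (x : ℂ) :
    IsProbabilityMeasure (noncohOutput σ A B x) := by
  rw [noncohOutput_eq_prod hA hB]
  have := isProbabilityMeasure_bitLaw hA (gaussianReal 0 (outputVar σ x))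
  have := isProbabilityMeasure_bitLaw hB (gaussianReal 0 (outputVar σ x))
  infer_instance

lemma klDiv_noncohOutput (hA : MeasurableSet A) (hB : MeasurableSet B) (x : ℂ) :
    klDiv (noncohOutput σ A B x) (noncohOutput σ A B 0) =
      klDiv (bitLaw A (gaussianReal 0 (outputVar σ x))) (bitLaw A (gaussianReal 0 (noiseVar σ))) +
      klDiv (bitLaw B (gaussianReal 0 (outputVar σ x)))
        (bitLaw B (gaussianReal 0 (noiseVar σ))) := by
  have p1 := isProbabilityMeasure_bitLaw hA (gaussianReal 0 (outputVar σ x))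
  have p2 := isProbabilityMeasure_bitLaw hB (gaussianReal 0 (outputVar σ x))
  have p3 := isProbabilityMeasure_bitLaw hA (gaussianReal 0 (noiseVar σ))
  have p4 := isProbabilityMeasure_bitLaw hB (gaussianReal 0 (noiseVar σ))
  rw [noncohOutput_eq_prod hA hB, noncohOutput_eq_prod hA hB, outputVar_zero, klDiv_prod]

lemma noncohOutput_ac (hσ : 0 < σ) (hA : MeasurableSet A) (hB : MeasurableSet B) (x : ℂ) :
    noncohOutput σ A B x ≪ noncohOutput σ A B 0 := by
  have h := gaussianReal_ac 0 (outputVar_ne_zero hσ x) (noiseVar_ne_zero hσ)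
  have p1 := isProbabilityMeasure_bitLaw hA (gaussianReal 0 (outputVar σ x))
  have p2 := isProbabilityMeasure_bitLaw hB (gaussianReal 0 (outputVar σ x))
  have p3 := isProbabilityMeasure_bitLaw hA (gaussianReal 0 (noiseVar σ))
  have p4 := isProbabilityMeasure_bitLaw hB (gaussianReal 0 (noiseVar σ))
  rw [noncohOutput_eq_prod hA hB, noncohOutput_eq_prod hA hB, outputVar_zero]
  exact (h.map (measurable_decide_mem hA)).prod (h.map (measurable_decide_mem hB))

lemma measurable_channel_noncoh (hA : MeasurableSet A) (hB : MeasurableSet B) :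
    Measurable fun p : ℂ × (ℂ × ℂ) => quantize A B (p.2.1 * p.1 + p.2.2) :=
  (measurable_quantize hA hB).comp (by fun_prop)

lemma noncohRate_le_capacityPerEnergy (hσ : 0 < σ) (hA : MeasurableSet A) (hB : MeasurableSet B)
    {ξ : ℂ} (hξ : ξ ≠ 0) : noncohRate σ A B ξ ≤ noncohCapacityPerEnergy σ := by
  have hp := isProbabilityMeasure_noncohOutput (σ := σ) hA hB
  have hac := noncohOutput_ac hσ hA hB
  have p1 := hp ξ
  have p0 := hp 0
  rw [noncohRate, ENNReal.div_le_iff (by simpa using hξ) (by finiteness)]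
  refine le_of_tendsto' (tendsto_klDiv_mixture (hac ξ) (fun n => (onOffProb_pos n).le)
    onOffProb_lt_one tendsto_onOffProb) fun n => ?_
  have h0 := onOffProb_pos n
  have h1 := onOffProb_lt_one n
  have hP : 0 < onOffProb n * ‖ξ‖ ^ 2 := by positivity
  have hlow : ENNReal.ofReal (onOffProb n) * klDiv (noncohOutput σ A B ξ)
      (mixture (onOffProb n) (noncohOutput σ A B ξ) (noncohOutput σ A B 0)) ≤
      noncohInfo σ A B (mixture (onOffProb n) (Measure.dirac ξ) (Measure.dirac 0)) :=
    le_mutualInfo_onOff (fadingLaw.prod (noiseLaw σ)) (measurable_channel_noncoh hA hB) h0.le h1 ξ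
      0 hac
  have hC : noncohInfo σ A B (mixture (onOffProb n) (Measure.dirac ξ) (Measure.dirac 0)) ≤
      noncohCapacity σ (onOffProb n * ‖ξ‖ ^ 2) :=
    le_iSup_of_le A <| le_iSup_of_le B <| le_iSup_of_le _ <| le_iSup_of_le hA <|
      le_iSup_of_le hB <| le_iSup_of_le (isAdmissibleInput_onOff h0.le h1.le ξ) le_rfl
  have h2 : noncohCapacity σ (onOffProb n * ‖ξ‖ ^ 2) / ENNReal.ofReal (onOffProb n * ‖ξ‖ ^ 2) ≤
      noncohCapacityPerEnergy σ := le_iSup₂_of_le _ hP le_rfl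
  rw [ENNReal.div_le_iff (by simpa using hP) (by finiteness)] at h2
  have h3 := hlow.trans (hC.trans h2)
  rw [ENNReal.ofReal_mul h0.le, ofReal_norm_sq, mul_left_comm] at h3
  exact (ENNReal.mul_le_mul_iff_right (by simpa using h0) (by finiteness)).1 h3

lemma klDiv_noncohOutput_le_mul {R : ℝ≥0∞}
    (hR : ∀ ξ : ℂ, ξ ≠ 0 → noncohRate σ A B ξ ≤ R) (hA : MeasurableSet A) (hB : MeasurableSet B)
    (x : ℂ) : klDiv (noncohOutput σ A B x) (noncohOutput σ A B 0) ≤ R * ‖x‖ₑ ^ 2 := by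
  by_cases hx : x = 0
  · have := isProbabilityMeasure_noncohOutput (σ := σ) hA hB 0
    rw [hx, klDiv_self]
    exact zero_le
  · have h := hR x hx
    rwa [noncohRate, ENNReal.div_le_iff (by simpa using hx) (by finiteness)] at h

lemma noncohCapacityPerEnergy_le (hσ : 0 < σ) {R : ℝ≥0∞}
    (hR : ∀ (ξ : ℂ) (A B : Set ℝ), ξ ≠ 0 → MeasurableSet A → MeasurableSet B →
      noncohRate σ A B ξ ≤ R) : noncohCapacityPerEnergy σ ≤ R := by
  refine iSup₂_le fun P _ => ENNReal.div_le_of_le_mul ?_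
  refine iSup_le fun A => iSup_le fun B => iSup_le fun μ => iSup_le fun hA => iSup_le fun hB =>
    iSup_le fun hμ => ?_
  have := hμ.1
  have := isProbabilityMeasure_noncohOutput (σ := σ) hA hB 0
  calc noncohInfo σ A B μ
      ≤ ∫⁻ x, klDiv (noncohOutput σ A B x) (noncohOutput σ A B 0) ∂μ :=
        mutualInfo_channel_le μ (fadingLaw.prod (noiseLaw σ)) (measurable_channel_noncoh hA hB) _
          (noncohOutput_ac hσ hA hB)
    _ ≤ ∫⁻ x, R * ‖x‖ₑ ^ 2 ∂μ := lintegral_mono fun x =>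
        klDiv_noncohOutput_le_mul (fun ξ hξ => hR ξ A B hξ hA hB) hA hB x
    _ = R * ∫⁻ x, ‖x‖ₑ ^ 2 ∂μ := lintegral_const_mul _ (by fun_prop)
    _ ≤ R * ENNReal.ofReal P := by gcongr; exact hμ.2

lemma noncohCapacityPerEnergy_eq_iSup (hσ : 0 < σ) :
    noncohCapacityPerEnergy σ =
      (⨆ (ξ : ℂ) (A : Set ℝ) (B : Set ℝ) (_ : ξ ≠ 0) (_ : MeasurableSet A)
        (_ : MeasurableSet B), noncohRate σ A B ξ) := by
  refine le_antisymm (noncohCapacityPerEnergy_le hσ fun ξ A B hξ hA hB => ?_) ?_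
  · exact le_iSup_of_le ξ <| le_iSup_of_le A <| le_iSup_of_le B <| le_iSup_of_le hξ <|
      le_iSup_of_le hA <| le_iSup_of_le hB le_rfl
  · exact iSup_le fun ξ => iSup_le fun A => iSup_le fun B => iSup_le fun hξ => iSup_le fun hA =>
      iSup_le fun hB => noncohRate_le_capacityPerEnergy hσ hA hB hξ

lemma noncohCapacityPerEnergy_lt (hσ : 0 < σ) :
    noncohCapacityPerEnergy σ < ENNReal.ofReal (1 / σ ^ 2) := by
  obtain ⟨c, hc0, hc1, hc⟩ := exists_klDiv_bitLaw_le
  have hσ2 : 0 < σ ^ 2 := by positivity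
  refine lt_of_le_of_lt (b := ENNReal.ofReal (c / σ ^ 2))
    (noncohCapacityPerEnergy_le hσ fun ξ A B hξ hA hB => ?_)
    ((ENNReal.ofReal_lt_ofReal_iff (by positivity)).2 (by gcongr))
  rw [noncohRate, ENNReal.div_le_iff (by simpa using hξ) (by finiteness), klDiv_noncohOutput hA hB]
  have h := hc (outputVar σ ξ) (noiseVar σ) (noiseVar_ne_zero hσ) (noiseVar_le_outputVar σ ξ)
  refine (add_le_add (h A hA) (h B hB)).trans (le_of_eq ?_)
  rw [outputVar_div σ hσ, ← ENNReal.ofReal_add (by simp; positivity) (by simp; positivity),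
    ← ofReal_norm_sq, ← ENNReal.ofReal_mul (by positivity)]
  congr 1
  field_simp
  ring

end Noncoherent

/-! ### Energy detection -/

/-- The probability that the square of a standard Gaussian is at least `y`. -/
noncomputable def energyTail (y : ℝ) : ℝ := (gaussianReal 0 1).real {u | u ^ 2 ∈ Ici y}

lemma measurableSet_energyRegion (T : ℝ) : MeasurableSet (energyRegion T) :=
  measurableSet_le measurable_const (by fun_prop)

lemma gaussianReal_energyRegion {v : ℝ≥0} (hv : v ≠ 0) (T : ℝ) :
    (gaussianReal 0 v).real (energyRegion T) = energyTail (T / v) := by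
  have hv' : (0 : ℝ) < v := by positivity
  rw [energyTail, ← gaussianReal_scaled_sq hv measurableSet_Ici]
  congr 1
  ext u
  exact (div_le_div_iff_of_pos_right hv').symm

lemma gaussianReal_Ici_eq (t : ℝ) : (gaussianReal 0 1).real (Ici t) = gaussianQ t := by
  have hn := nullSingletonClass_gaussianReal (μ := 0) (v := 1) one_ne_zero
  rw [measureReal_congr (Ioi_ae_eq_Ici (a := t)).symm, measureReal_def,
    gaussianReal_apply_eq_integral 0 one_ne_zero, ENNReal.toReal_ofReal
    (setIntegral_nonneg measurableSet_Ioi fun _ _ => gaussianPDFReal_nonneg _ _ _), gaussianQ,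
    ← integral_const_mul]
  refine setIntegral_congr_fun measurableSet_Ioi fun u _ => ?_
  simp [gaussianPDFReal]

lemma energyTail_eq {t : ℝ} (ht : 0 < t) : energyTail (t ^ 2) = 2 * gaussianQ t := by
  have hset : {u : ℝ | u ^ 2 ∈ Ici (t ^ 2)} = Ici t ∪ Iic (-t) := by
    ext u
    simp only [mem_ofPred_eq, mem_Ici, mem_union, mem_Iic]
    rw [sq_le_sq, abs_of_pos ht, le_abs, le_neg]
  have hneg : (gaussianReal 0 1).real (Iic (-t)) = (gaussianReal 0 1).real (Ici t) := by
    have h := gaussianReal_map_neg (μ := 0) (v := 1)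
    rw [neg_zero] at h
    conv_lhs => rw [← h]
    rw [map_measureReal_apply measurable_neg measurableSet_Iic]
    congr 1
    ext u
    simp
  have hdisj : Disjoint (Ici t) (Iic (-t)) := by
    rw [Set.disjoint_left]
    intro u h1 h2
    simp only [mem_Ici, mem_Iic] at h1 h2
    linarith
  rw [energyTail, hset, measureReal_union hdisj measurableSet_Iic, hneg, gaussianReal_Ici_eq]
  ring

lemma gaussianQ_le {t : ℝ} (ht : 0 ≤ t) : gaussianQ t ≤ Real.exp (-(t ^ 2 / 2)) := by
  have h := gaussianReal_upper_tail (v := 1) one_ne_zero ht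
  rw [sub_zero, NNReal.coe_one, mul_one] at h
  rw [← gaussianReal_Ici_eq]
  exact h

lemma le_gaussianQ {t : ℝ} (ht : 0 ≤ t) :
    (√(2 * Real.pi))⁻¹ * Real.exp (-((t + 1) ^ 2 / 2)) ≤ gaussianQ t := by
  rw [← gaussianReal_Ici_eq]
  have h1 : (gaussianReal 0 1).real (Icc t (t + 1)) ≤ (gaussianReal 0 1).real (Ici t) :=
    measureReal_mono Icc_subset_Ici_self
  refine le_trans ?_ h1
  rw [measureReal_def, gaussianReal_apply_eq_integral 0 one_ne_zero, ENNReal.toReal_ofReal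
    (setIntegral_nonneg measurableSet_Icc fun _ _ => gaussianPDFReal_nonneg _ _ _)]
  have h2 : ∫ u in Icc t (t + 1), (√(2 * Real.pi))⁻¹ * Real.exp (-((t + 1) ^ 2 / 2)) =
      (√(2 * Real.pi))⁻¹ * Real.exp (-((t + 1) ^ 2 / 2)) := by
    rw [setIntegral_const, measureReal_def, Real.volume_Icc]
    simp
  rw [← h2]
  refine setIntegral_mono_on (integrableOn_const (by simp))
    (integrable_gaussianPDFReal 0 1).integrableOn measurableSet_Icc fun u hu => ?_
  simp only [gaussianPDFReal, NNReal.coe_one, mul_one, sub_zero]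
  gcongr
  rw [neg_div]
  have : u ^ 2 ≤ (t + 1) ^ 2 := by
    have := hu.1
    have := hu.2
    gcongr
    linarith
  linarith

lemma tendsto_gaussianQ : Tendsto gaussianQ atTop (𝓝 0) := by
  have h : Tendsto (fun t : ℝ => Real.exp (-(t ^ 2 / 2))) atTop (𝓝 0) :=
    Real.tendsto_exp_neg_atTop_nhds_zero.comp
      ((tendsto_pow_atTop two_ne_zero).atTop_div_const two_pos)
  refine squeeze_zero' ?_ ?_ h
  · filter_upwards with t
    rw [← gaussianReal_Ici_eq]
    exact measureReal_nonneg
  · filter_upwards [eventually_ge_atTop 0] with t ht using gaussianQ_le ht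

/-- The exponential decay rate of the Gaussian tail. -/
lemma tendsto_neg_log_gaussianQ_div :
    Tendsto (fun t => -Real.log (2 * gaussianQ t) / (t ^ 2 - 1)) atTop (𝓝 (1 / 2)) := by
  have hinv : Tendsto (fun t : ℝ => t⁻¹) atTop (𝓝 0) := tendsto_inv_atTop_zero
  have hden : Tendsto (fun t : ℝ => 1 - t⁻¹ ^ 2) atTop (𝓝 1) := by
    simpa using (tendsto_const_nhds (x := (1 : ℝ))).sub (hinv.pow 2)
  have hlow : Tendsto (fun t : ℝ => (1 / 2 - Real.log 2 * t⁻¹ ^ 2) / (1 - t⁻¹ ^ 2)) atTop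
      (𝓝 (1 / 2)) := by
    have := ((tendsto_const_nhds (x := (1 / 2 : ℝ))).sub ((hinv.pow 2).const_mul (Real.log 2))).div
      hden one_ne_zero
    simpa [Pi.div_def] using this
  have hup : Tendsto (fun t : ℝ => ((1 + t⁻¹) ^ 2 / 2 +
      (Real.log √(2 * Real.pi) - Real.log 2) * t⁻¹ ^ 2) / (1 - t⁻¹ ^ 2)) atTop (𝓝 (1 / 2)) := by
    have := (((((tendsto_const_nhds (x := (1 : ℝ))).add hinv).pow 2).div_const 2).add
      ((hinv.pow 2).const_mul (Real.log √(2 * Real.pi) - Real.log 2))).div hden one_ne_zero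
    simpa [Pi.div_def] using this
  refine tendsto_of_tendsto_of_tendsto_of_le_of_le' hlow hup ?_ ?_
  all_goals
    filter_upwards [eventually_gt_atTop 1] with t ht
    have ht0 : 0 < t := by linarith
    have hd : 0 < t ^ 2 - 1 := by nlinarith
    have hd' : 1 - t⁻¹ ^ 2 = (t ^ 2 - 1) / t ^ 2 := by field_simp
    have hpi : 0 < √(2 * Real.pi) := by positivity
    have hl := le_gaussianQ ht0.le
    have hq : 0 < gaussianQ t := lt_of_lt_of_le (by positivity) hl
    rw [Real.log_mul two_ne_zero hq.ne', hd', div_div_eq_mul_div]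
    gcongr
  · have h := Real.log_le_log hq (gaussianQ_le ht0.le)
    rw [Real.log_exp] at h
    have : (1 / 2 - Real.log 2 * t⁻¹ ^ 2) * t ^ 2 = t ^ 2 / 2 - Real.log 2 := by field_simp
    linarith
  · have h := Real.log_le_log (by positivity) hl
    rw [Real.log_mul (by positivity) (by positivity), Real.log_exp, Real.log_inv] at h
    have : ((1 + t⁻¹) ^ 2 / 2 + (Real.log √(2 * Real.pi) - Real.log 2) * t⁻¹ ^ 2) * t ^ 2 =
        (t + 1) ^ 2 / 2 + (Real.log √(2 * Real.pi) - Real.log 2) := by field_simp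
    linarith

/-- The rate of energy detection, in terms of `t = √(1 + |ξ|² / σ²)`. -/
noncomputable def energyRate (σ t : ℝ) : ℝ :=
  2 * (2 * gaussianQ 1 * -Real.log (2 * gaussianQ t) +
    (1 - 2 * gaussianQ 1) * -Real.log (1 - 2 * gaussianQ t) -
      Real.binEntropy (2 * gaussianQ 1)) / (σ ^ 2 * (t ^ 2 - 1))

lemma tendsto_energyRate {σ : ℝ} (hσ : 0 < σ) :
    Tendsto (energyRate σ) atTop (𝓝 (2 * gaussianQ 1 / σ ^ 2)) := by
  have hden : Tendsto (fun t : ℝ => t ^ 2 - 1) atTop atTop :=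
    tendsto_atTop_add_const_right _ _ (tendsto_pow_atTop two_ne_zero)
  have h1 := tendsto_neg_log_gaussianQ_div.const_mul (2 * gaussianQ 1)
  have h2 : Tendsto (fun t => -Real.log (1 - 2 * gaussianQ t)) atTop (𝓝 0) := by
    have h := (tendsto_const_nhds (x := (1 : ℝ))).sub (tendsto_gaussianQ.const_mul 2)
    rw [mul_zero, sub_zero] at h
    simpa using (h.log one_ne_zero).neg
  have h3 := (((h2.const_mul (1 - 2 * gaussianQ 1)).sub_const
    (Real.binEntropy (2 * gaussianQ 1)))).div_atTop hden
  have h := (h1.add h3).const_mul (2 / σ ^ 2)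
  rw [show 2 / σ ^ 2 * (2 * gaussianQ 1 * (1 / 2) + 0) = 2 * gaussianQ 1 / σ ^ 2 by ring] at h
  refine h.congr' ?_
  filter_upwards [eventually_gt_atTop 1] with t ht
  have hd : t ^ 2 - 1 ≠ 0 := by nlinarith
  rw [energyRate]
  field_simp
  ring

lemma noncohRate_energyRegion {σ : ℝ} (hσ : 0 < σ) {ξ : ℂ} (hξ : ξ ≠ 0) :
    noncohRate σ (energyRegion ((‖ξ‖ ^ 2 + σ ^ 2) / 2)) (energyRegion ((‖ξ‖ ^ 2 + σ ^ 2) / 2)) ξ =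
      ENNReal.ofReal (energyRate σ √(‖ξ‖ ^ 2 / σ ^ 2 + 1)) := by
  have hS := measurableSet_energyRegion ((‖ξ‖ ^ 2 + σ ^ 2) / 2)
  have hv := outputVar_ne_zero hσ ξ
  have hw := noiseVar_ne_zero hσ
  have hv' : (outputVar σ ξ : ℝ) ≠ 0 := by exact_mod_cast hv
  have ht : 0 < √(‖ξ‖ ^ 2 / σ ^ 2 + 1) := by positivity
  have hsq : √(‖ξ‖ ^ 2 / σ ^ 2 + 1) ^ 2 = ‖ξ‖ ^ 2 / σ ^ 2 + 1 := Real.sq_sqrt (by positivity)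
  have hp : (gaussianReal 0 (outputVar σ ξ)).real (energyRegion ((‖ξ‖ ^ 2 + σ ^ 2) / 2)) =
      2 * gaussianQ 1 := by
    rw [gaussianReal_energyRegion hv, ← coe_outputVar, div_self hv', ← energyTail_eq one_pos,
      one_pow]
  have hq : (gaussianReal 0 (noiseVar σ)).real (energyRegion ((‖ξ‖ ^ 2 + σ ^ 2) / 2)) =
      2 * gaussianQ √(‖ξ‖ ^ 2 / σ ^ 2 + 1) := by
    rw [gaussianReal_energyRegion hw, ← coe_outputVar, outputVar_div σ hσ, ← energyTail_eq ht, hsq]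
  have hn : 0 < ‖ξ‖ := norm_pos_iff.2 hξ
  rw [noncohRate, klDiv_noncohOutput hS hS,
    klDiv_bitLaw_eq_binEntropy hS (gaussianReal_ac 0 hv hw), probReal_compl_eq_one_sub hS,
    probReal_compl_eq_one_sub hS, hp, hq, ← two_mul, ← ofReal_norm_sq,
    ← ENNReal.ofReal_ofNat 2, ← ENNReal.ofReal_mul two_pos.le,
    ← ENNReal.ofReal_div_of_pos (by positivity), energyRate, hsq]
  congr 2
  field_simp
  ring

lemma tendsto_noncohRate_energyRegion {σ : ℝ} (hσ : 0 < σ) :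
    Tendsto (fun ξ : ℂ => noncohRate σ (energyRegion ((‖ξ‖ ^ 2 + σ ^ 2) / 2))
      (energyRegion ((‖ξ‖ ^ 2 + σ ^ 2) / 2)) ξ)
      (Bornology.cobounded ℂ) (𝓝 (ENNReal.ofReal (2 * gaussianQ 1 / σ ^ 2))) := by
  have ht : Tendsto (fun ξ : ℂ => √(‖ξ‖ ^ 2 / σ ^ 2 + 1)) (Bornology.cobounded ℂ) atTop :=
    Real.tendsto_sqrt_atTop.comp (tendsto_atTop_add_const_right _ _
      (((tendsto_pow_atTop two_ne_zero).comp tendsto_norm_cobounded_atTop).atTop_div_const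
        (by positivity)))
  refine ((ENNReal.continuous_ofReal.tendsto _).comp ((tendsto_energyRate hσ).comp ht)).congr' ?_
  filter_upwards [tendsto_norm_cobounded_atTop.eventually (eventually_gt_atTop 0)] with ξ hξ
  exact (noncohRate_energyRegion hσ (norm_pos_iff.1 hξ)).symm

lemma le_iSup_noncohRate_energyRegion {σ : ℝ} (hσ : 0 < σ) :
    ENNReal.ofReal (2 * gaussianQ 1 / σ ^ 2) ≤
      (⨆ (ξ : ℂ) (_ : ξ ≠ 0), noncohRate σ (energyRegion ((‖ξ‖ ^ 2 + σ ^ 2) / 2))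
        (energyRegion ((‖ξ‖ ^ 2 + σ ^ 2) / 2)) ξ) := by
  have hne : (Bornology.cobounded ℂ).NeBot := inferInstance
  refine le_of_tendsto (tendsto_noncohRate_energyRegion hσ) ?_
  filter_upwards [tendsto_norm_cobounded_atTop.eventually (eventually_gt_atTop 0)] with ξ hξ
  exact le_iSup₂_of_le ξ (norm_pos_iff.1 hξ) le_rfl

end FadingChannel

theorem theorem2 (σ : ℝ) (hσ : 0 < σ) :
    -- coherent case
    (cohCapacityPerEnergy σ = ENNReal.ofReal (1 / σ ^ 2) ∧
      cohCapacityPerEnergy σ =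
        (⨆ (ξ : ℂ) (A : ℂ → Set ℝ) (B : ℂ → Set ℝ) (_ : ξ ≠ 0) (_ : IsBorelFamily A)
          (_ : IsBorelFamily B), cohRate σ A B ξ) ∧
      ∃ TR TI : ℝ → ℝ, Measurable TR ∧ Measurable TI ∧
        (⨆ (ξ : ℂ) (_ : ξ ≠ 0),
          cohRate σ (fun h => {u | TR (h * ξ).re ≤ u}) (fun h => {u | TI (h * ξ).im ≤ u}) ξ) =
            ENNReal.ofReal (1 / σ ^ 2)) ∧
    -- noncoherent case
    (ENNReal.ofReal (2 * gaussianQ 1 / σ ^ 2) ≤ noncohCapacityPerEnergy σ ∧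
      noncohCapacityPerEnergy σ < ENNReal.ofReal (1 / σ ^ 2) ∧
      noncohCapacityPerEnergy σ =
        (⨆ (ξ : ℂ) (A : Set ℝ) (B : Set ℝ) (_ : ξ ≠ 0) (_ : MeasurableSet A)
          (_ : MeasurableSet B), noncohRate σ A B ξ) ∧
      ENNReal.ofReal (2 * gaussianQ 1 / σ ^ 2) ≤
        (⨆ (ξ : ℂ) (_ : ξ ≠ 0),
          noncohRate σ (energyRegion ((‖ξ‖ ^ 2 + σ ^ 2) / 2))
            (energyRegion ((‖ξ‖ ^ 2 + σ ^ 2) / 2)) ξ) ∧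
      Tendsto (fun ξ : ℂ =>
          noncohRate σ (energyRegion ((‖ξ‖ ^ 2 + σ ^ 2) / 2))
            (energyRegion ((‖ξ‖ ^ 2 + σ ^ 2) / 2)) ξ)
        (Bornology.cobounded ℂ) (𝓝 (ENNReal.ofReal (2 * gaussianQ 1 / σ ^ 2)))) := by
  have hup : (⨆ (ξ : ℂ) (A : ℂ → Set ℝ) (B : ℂ → Set ℝ) (_ : ξ ≠ 0) (_ : IsBorelFamily A)
      (_ : IsBorelFamily B), cohRate σ A B ξ) ≤ cohCapacityPerEnergy σ :=
    iSup_le fun ξ => iSup_le fun A => iSup_le fun B => iSup_le fun hξ => iSup_le fun hA =>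
      iSup_le fun hB => cohRate_le_capacityPerEnergy hσ hA hB hξ
  have hfam := fun ξ : ℂ => isBorelFamily_threshold measurable_threshold
    (f := fun h : ℂ => (h * ξ).re) (by fun_prop)
  have hfam' := fun ξ : ℂ => isBorelFamily_threshold measurable_threshold
    (f := fun h : ℂ => (h * ξ).im) (by fun_prop)
  have hthr : (⨆ (ξ : ℂ) (_ : ξ ≠ 0), cohRate σ (fun h => {u | threshold (h * ξ).re ≤ u})
        (fun h => {u | threshold (h * ξ).im ≤ u}) ξ) ≤
      (⨆ (ξ : ℂ) (A : ℂ → Set ℝ) (B : ℂ → Set ℝ) (_ : ξ ≠ 0) (_ : IsBorelFamily A)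
        (_ : IsBorelFamily B), cohRate σ A B ξ) :=
    iSup₂_le fun ξ hξ => le_iSup_of_le ξ <| le_iSup_of_le _ <| le_iSup_of_le _ <|
      le_iSup_of_le hξ <| le_iSup_of_le (hfam ξ) <| le_iSup_of_le (hfam' ξ) le_rfl
  have hlow := le_iSup_cohRate_threshold hσ
  have hcap := cohCapacityPerEnergy_le hσ
  refine ⟨⟨le_antisymm hcap (hlow.trans (hthr.trans hup)),
    le_antisymm (hcap.trans (hlow.trans hthr)) hup, threshold, threshold, measurable_threshold,
    measurable_threshold, le_antisymm (hthr.trans (hup.trans hcap)) hlow⟩, ?_,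
    noncohCapacityPerEnergy_lt hσ, noncohCapacityPerEnergy_eq_iSup hσ,
    le_iSup_noncohRate_energyRegion hσ, tendsto_noncohRate_energyRegion hσ⟩
  exact (le_iSup_noncohRate_energyRegion hσ).trans (iSup₂_le fun ξ hξ =>
    noncohRate_le_capacityPerEnergy hσ (measurableSet_energyRegion _)
      (measurableSet_energyRegion _) hξ)
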